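/- Let $X$ be a smooth open $n$-manifold, i.e. a Hausdorff, second countable $C^\infty$ manifold of dimension $n$ without boundary and without compact components ($X$ may be disconnected). Definitions. A neighborhood system of infinity in $X$ is a sequence $U_0\supset U_1\supset\cdots$ of complements of compact sets with $\overline{U_{i+1}}\subset U_i$ and $\bigcap_i U_i=\emptyset$; an end $\epsilon$ of $X$ is an element of $\varprojlim\pi_0(U_i)$, i.e. a nested sequence $V_0\supset V_1\supset\cdots$ with $V_i$ a component of $U_i$. A subset of $X$ contains $\epsilon$ if it contains some $V_i$. A singular ray determining $\epsilon$ is a proper continuous map $\gamma:[0,\infty)\to X$ that is eventually in each $V_i$; we parametrize it so that $\gamma([i,\infty))\subset U_i$ for all $i$. The fundamental progroup of $X$ based at $\gamma$ is the inverse sequence of groups $\pi_1(U_i,\gamma(i))$ whose maps $\pi_1(U_{i+1},\gamma(i+1))\to\pi_1(U_i,\gamma(i))$ are induced by inclusion followed by the change of base point along $\gamma|_{[i,i+1]}$. An inverse sequence of groups $G_0\leftarrow G_1\leftarrow\cdots$ is Mittag-Leffler if for each $i$ there is $j\ge i$ such that all $G_k$ with $k\ge j$ have the same image in $G_i$. The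 end $\epsilon$ is Mittag-Leffler if there is a singular ray determining it and the fundamental progroup based at every singular ray determining $\epsilon$ is Mittag-Leffler (as is well known, every end is determined by some singular ray, and it is equivalent to require the condition for one such ray). A Morse function is a $C^\infty$ function $X\to\mathbb R$ all of whose critical points are nondegenerate; it is exhausting if it is proper and bounded below. The index of a critical point is the maximal dimension of a subspace on which the Hessian is negative definite. Proposition. If an end $\epsilon$ of $X$ is not Mittag-Leffler, then for every exhausting Morse function $\varphi$ on $X$ and every $t\in\mathbb R$, there are infinitely many critical points of $\varphi$ of index $n-1$ in the component of $\varphi^{-1}(t,\infty)$ containing $\epsilon$. In particular, if $X$ admits an exhausting Morse function with only finitely many critical points of index $n-1$, then all ends of $X$ are Mittag-Leffler. -/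

import Mathlib

open Set Filter Topology Manifold
open scoped NNReal ContDiff

noncomputable section

namespace EndTheory

/-! ### Neighborhood systems of infinity and ends -/

/-- A neighborhood system of infinity in `X`: a nested sequence of complements of compact sets, with
empty intersection, the closure of each term being contained in the preceding term. -/
structure NbhdSystem (X : Type*) [TopologicalSpace X] where
  /-- the sequence of neighborhoods of infinity -/
  U : ℕ → Set X
  isCompact_compl : ∀ i, IsCompact (U i)ᶜ
  closure_subset : ∀ i, closure (U (i + 1)) ⊆ U i
  iInter_eq_empty : ⋂ i, U i = ∅

/-- `C` is a connected component of the subset `W` of `X`. -/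
def IsComponentOf {X : Type*} [TopologicalSpace X] (C W : Set X) : Prop :=
  ∃ x ∈ W, C = connectedComponentIn W x

/-- An end of `X`, with respect to a neighborhood system `U` of infinity: an element of the inverse
limit of the `π₀(U i)`, i.e. a nested sequence of components `V i` of `U i`. -/
structure SpaceEnd {X : Type*} [TopologicalSpace X] (S : NbhdSystem X) where
  /-- the component of `U i` selected by the end -/
  V : ℕ → Set X
  isComponentOf : ∀ i, IsComponentOf (V i) (S.U i)
  subset : ∀ i, V (i + 1) ⊆ V i

/-- The set `C` contains (is a neighborhood of) the end `ε` if it contains some `V i`. -/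
def SpaceEnd.IsContainedIn {X : Type*} [TopologicalSpace X] {S : NbhdSystem X} (ε : SpaceEnd S)
    (C : Set X) : Prop :=
  ∃ i, ε.V i ⊆ C

/-! ### Inverse sequences of groups -/

/-- The composite homomorphism `G (i + m) → G (i + m - 1) → ⋯ → G i` of an inverse sequence. -/
def transition {G : ℕ → Type*} [∀ i, Group (G i)] (f : ∀ i, G (i + 1) →* G i) (i : ℕ) :
    ∀ m : ℕ, G (i + m) →* G i
  | 0 => MonoidHom.id (G i)
  | m + 1 => (transition f i m).comp (f (i + m))

/-- The inverse sequence `G 0 ← G 1 ← G 2 ← ⋯` is Mittag-Leffler: for each `i` there is `j ≥ i`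
such that all `G k` with `k ≥ j` have the same image in `G i` (here `j = i + m` and `k = i + l`). -/
def IsMittagLefflerSeq {G : ℕ → Type*} [∀ i, Group (G i)] (f : ∀ i, G (i + 1) →* G i) : Prop :=
  ∀ i, ∃ m, ∀ l, m ≤ l → (transition f i l).range = (transition f i m).range

/-! ### Rays and the fundamental progroup -/

/-- A singular ray in `X`, i.e. a proper continuous map `[0, ∞) → X`, parametrized so that
`γ [i, ∞) ⊆ U i` for all `i`. -/
structure Ray {X : Type*} [TopologicalSpace X] (S : NbhdSystem X) where
  /-- the underlying map -/
  γ : C(ℝ≥0, X)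
  isProperMap : IsProperMap γ
  mem : ∀ (i : ℕ) (s : ℝ≥0), (i : ℝ≥0) ≤ s → γ s ∈ S.U i

namespace Ray

variable {X : Type*} [TopologicalSpace X] {S : NbhdSystem X} (r : Ray S)

/-- The end determined by the singular ray is `ε`: the ray is eventually in each `V i`. -/
def Determines (ε : SpaceEnd S) : Prop :=
  ∀ i, ∀ᶠ s in atTop, r.γ s ∈ ε.V i

/-- The base point `γ i` of `U i`. -/
def basePoint (i : ℕ) : S.U i := ⟨r.γ i, r.mem i i le_rfl⟩

/-- The inclusion `U (i + 1) → U i`. -/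
def incl (S : NbhdSystem X) (i : ℕ) : C(S.U (i + 1), S.U i) :=
  ⟨Set.inclusion (subset_closure.trans (S.closure_subset i)), continuous_inclusion _⟩

/-- The path `γ|[i, i + 1]` in `U i`, from `γ i` to `γ (i + 1)`. -/
def segment (i : ℕ) : Path (r.basePoint i) (incl S i (r.basePoint (i + 1))) where
  toFun t := ⟨r.γ (i + unitInterval.toNNReal t), r.mem i _ le_self_add⟩
  continuous_toFun := by
    refine Continuous.subtype_mk (r.γ.continuous.comp ?_) _
    exact continuous_const.add unitInterval.toNNReal_continuous
  source' := by
    apply Subtype.ext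
    simp [basePoint]
  target' := by
    apply Subtype.ext
    simp [basePoint, incl]

/-- The homomorphism `π₁(U (i + 1), γ (i + 1)) → π₁(U i, γ i)` of the fundamental progroup: the map
induced by inclusion, followed by the change of base point along `γ|[i, i + 1]`. -/
def bond (i : ℕ) : FundamentalGroup (S.U (i + 1)) (r.basePoint (i + 1)) →*
    FundamentalGroup (S.U i) (r.basePoint i) :=
  (FundamentalGroup.fundamentalGroupMulEquivOfPath (r.segment i).symm).toMonoidHom.comp
    (FundamentalGroup.map (incl S i) (r.basePoint (i + 1)))

/-- The fundamental progroup of `X` based at the ray is Mittag-Leffler. -/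
def IsMittagLeffler : Prop :=
  IsMittagLefflerSeq (G := fun i => FundamentalGroup (S.U i) (r.basePoint i)) r.bond

end Ray

/-- An end is Mittag-Leffler if the fundamental progroup of `X` based at a singular ray determining
the end is Mittag-Leffler. The condition does not depend on the ray; it is required
here for all rays determining the end (and that there is such a ray). -/
def SpaceEnd.IsMittagLeffler {X : Type*} [TopologicalSpace X] {S : NbhdSystem X}
    (ε : SpaceEnd S) : Prop :=
  (∃ r : Ray S, r.Determines ε) ∧ ∀ r : Ray S, r.Determines ε → r.IsMittagLeffler

/-! ### Morse functions -/

/-- `x` is a critical point of `φ`: the differential vanishes at `x`. -/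
def IsCritical (n : ℕ) {X : Type*} [TopologicalSpace X]
    [ChartedSpace (EuclideanSpace ℝ (Fin n)) X] (φ : X → ℝ) (x : X) : Prop :=
  mfderiv (𝓡 n) 𝓘(ℝ, ℝ) φ x = 0

/-- The Hessian of `φ` at `x` in the preferred chart at `x`, as a bilinear form on `ℝⁿ`. It is used
only at critical points, where a change of chart replaces it by a congruent form. -/
def hessian (n : ℕ) {X : Type*} [TopologicalSpace X]
    [ChartedSpace (EuclideanSpace ℝ (Fin n)) X] (φ : X → ℝ) (x : X) :
    LinearMap.BilinForm ℝ (EuclideanSpace ℝ (Fin n)) :=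
  (fderiv ℝ (fderiv ℝ (φ ∘ (chartAt (EuclideanSpace ℝ (Fin n)) x).symm))
    (chartAt (EuclideanSpace ℝ (Fin n)) x x)).toLinearMap₁₂

/-- A Morse function: a smooth function all of whose critical points are nondegenerate. -/
def IsMorse (n : ℕ) {X : Type*} [TopologicalSpace X]
    [ChartedSpace (EuclideanSpace ℝ (Fin n)) X] (φ : X → ℝ) : Prop :=
  ContMDiff (𝓡 n) 𝓘(ℝ, ℝ) ∞ φ ∧ ∀ x, IsCritical n φ x → (hessian n φ x).Nondegenerate

/-- The index at a critical point: the maximal dimension of a subspace on which the Hessian is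
negative definite. -/
def morseIndex (n : ℕ) {X : Type*} [TopologicalSpace X]
    [ChartedSpace (EuclideanSpace ℝ (Fin n)) X] (φ : X → ℝ) (x : X) : ℕ :=
  sigNeg (LinearMap.BilinMap.toQuadraticMap (hessian n φ x))

/-- An exhausting function: proper and bounded below. -/
def IsExhausting {X : Type*} [TopologicalSpace X] (φ : X → ℝ) : Prop :=
  IsProperMap φ ∧ BddBelow (range φ)

/-- `x` is a critical point of `φ` of index `n - 1`. -/
def IsCriticalOfCoindexOne (n : ℕ) {X : Type*} [TopologicalSpace X]
    [ChartedSpace (EuclideanSpace ℝ (Fin n)) X] (φ : X → ℝ) (x : X) : Prop :=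
  IsCritical n φ x ∧ morseIndex n φ x + 1 = n

end EndTheory

end

noncomputable section

namespace EndTheory

/-! ### Local conditions for raising paths above a level -/

/-! The contrapositive is proved: if the component of `{t < φ}` containing the end has only finitely
many critical points of index `n - 1`, choose a level `s` above all of them. In the component `D` of
`{s < φ}` that contains the tail of the ray, a path whose endpoints lie above a level `b` is
homotopic in `D`, with fixed endpoints, to a path above `b` (`exists_raise_in_component`). Hence
loops in a fixed `U j` deform, inside `U i`, into `U k` for every `k`, once their base points are
moved far out along the ray; this is the Mittag-Leffler condition (`Ray.isMittagLeffler_of_push`).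

Paths are raised without gradient flows or transversality. At a regular point, or at a critical
point with at least two ascending directions, the part of a small neighborhood above the critical
value is connected, so short paths can be replaced by paths above the level; they stay homotopic
because short paths with common endpoints are homotopic in a manifold. A critical point of index `n`
is a strict local maximum, and a path coming from above and dipping only slightly below its value
cannot get near it. Only index `n - 1`, with a single ascending direction, is excluded. `RaisableAt`
records the admissible behavior, `IsMorse.raisableAt` verifies it, `exists_raise_level` passes one
level by compactness, and `exists_raise` reaches any level by a supremum argument. -/

/-- Near `x`, any two points above the level of `x` can be joined above that level by a path that
stays near `x`. -/
def UpperConnectedAt {Y : Type*} [TopologicalSpace Y] (f : Y → ℝ) (x : Y) : Prop :=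
  ∀ V ∈ 𝓝 x, ∃ N ∈ 𝓝 x, ∀ a ∈ N, ∀ b ∈ N, f x < f a → f x < f b →
    JoinedIn (V ∩ {z | f x < f z}) a b

/-- The local condition at `x` that allows paths to be pushed above the level of `x`: either `x` is
a strict local maximum, or it is not a local maximum and `f` is upper connected at `x`. -/
def RaisableAt {Y : Type*} [TopologicalSpace Y] (f : Y → ℝ) (x : Y) : Prop :=
  ((∃ᶠ z in 𝓝 x, f x < f z) ∧ UpperConnectedAt f x) ∨ ∀ᶠ z in 𝓝[≠] x, f z < f x

/-- Every point has a neighborhood such that any two paths in it with the same endpoints are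
homotopic in the whole space. -/
def LocallyUniqueHomotopy (Y : Type*) [TopologicalSpace Y] : Prop :=
  ∀ y : Y, ∃ W ∈ 𝓝 y, ∀ (a b : Y) (p q : Path a b), range p ⊆ W → range q ⊆ W → p.Homotopic q

/-- Paths in `O` with endpoints above level `c` are homotopic to paths above level `c`. -/
def UniquelyRaises {Y : Type*} [TopologicalSpace Y] (f : Y → ℝ) (c : ℝ) (O : Set Y) : Prop :=
  ∀ (a b : Y) (p : Path a b), c < f a → c < f b → range p ⊆ O →
    ∃ q : Path a b, (∀ t, c < f (q t)) ∧ p.Homotopic q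

/-- Paths above level `c'` starting above level `c` do not meet `O`. -/
def Unreachable {Y : Type*} [TopologicalSpace Y] (f : Y → ℝ) (c c' : ℝ) (O : Set Y) : Prop :=
  ∀ (a b : Y) (p : Path a b), c < f a → (∀ t, c' < f (p t)) → ∀ t, p t ∉ O

/-! ### Consequences of the local conditions near one point -/

section Topological

variable {Y : Type*} [TopologicalSpace Y] {f : Y → ℝ}

lemma UniquelyRaises.mono {c : ℝ} {O O' : Set Y} (h : UniquelyRaises f c O) (hO : O' ⊆ O) :
    UniquelyRaises f c O' :=
  fun a b p ha hb hp => h a b p ha hb (hp.trans hO)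

lemma Unreachable.mono {c c' d : ℝ} {O O' : Set Y} (h : Unreachable f c c' O) (hO : O' ⊆ O)
    (hd : c' ≤ d) : Unreachable f c d O' :=
  fun a b p ha hp t ht => h a b p ha (fun s => hd.trans_lt (hp s)) t (hO ht)

/-- Upper connectedness supplies a replacement path inside a set where paths with common endpoints
are homotopic, so the homotopy costs nothing. -/
lemma UpperConnectedAt.exists_uniquelyRaises {x : Y} (h : UpperConnectedAt f x)
    (hY : LocallyUniqueHomotopy Y) : ∃ O ∈ 𝓝 x, UniquelyRaises f (f x) O := by
  obtain ⟨W, hW, hW'⟩ := hY x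
  obtain ⟨N, hN, hN'⟩ := h W hW
  refine ⟨N ∩ W, inter_mem hN hW, fun a b p ha hb hp => ?_⟩
  have hj := hN' a (hp ⟨0, p.source⟩).1 b (hp ⟨1, p.target⟩).1 ha hb
  refine ⟨hj.somePath, fun t => (hj.somePath_mem t).2, hW' a b _ _ (hp.trans inter_subset_right) ?_⟩
  rintro _ ⟨t, rfl⟩
  exact (hj.somePath_mem t).1

lemma IsPreconnected.inter_frontier_nonempty' {S L : Set Y} (hS : IsPreconnected S)
    (h1 : (S ∩ interior L).Nonempty) (h2 : (S ∩ (closure L)ᶜ).Nonempty) :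
    (S ∩ frontier L).Nonempty := by
  by_contra h
  rw [not_nonempty_iff_eq_empty] at h
  obtain ⟨z, hz, hz1, hz2⟩ := hS (interior L) (closure L)ᶜ isOpen_interior
    isClosed_closure.isOpen_compl (fun z hz => by
      by_cases hzi : z ∈ interior L
      · exact Or.inl hzi
      · refine Or.inr fun hzc => ?_
        have : z ∈ S ∩ frontier L := ⟨hz, hzc, hzi⟩
        rw [h] at this
        exact this) h1 h2
  exact hz2 (subset_closure (interior_subset hz1))

/-- A strict maximum is surrounded by the compact frontier of a small neighborhood, on which `f` has
a maximum `c'` below `f x`. A path starting above `f x` starts outside the neighborhood and can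
enter only through this frontier. -/
lemma exists_unreachable [T2Space Y] [LocallyCompactSpace Y] (hf : Continuous f) {x : Y}
    (h : ∀ᶠ z in 𝓝[≠] x, f z < f x) : ∃ O ∈ 𝓝 x, ∃ c' < f x, Unreachable f (f x) c' O := by
  rw [eventually_nhdsWithin_iff] at h
  obtain ⟨L, hL, hLs, hLc⟩ := local_compact_nhds h
  have hle : ∀ z ∈ L, f z ≤ f x := fun z hz => by
    by_cases hzx : z = x
    · rw [hzx]
    · exact (hLs hz hzx).le
  have hxi : x ∈ interior L := mem_interior_iff_mem_nhds.2 hL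
  have hfr : IsCompact (frontier L) := hLc.of_isClosed_subset isClosed_frontier
    (hLc.isClosed.frontier_subset)
  obtain ⟨c', hc', hc''⟩ : ∃ c' < f x, ∀ z ∈ frontier L, f z ≤ c' := by
    rcases (frontier L).eq_empty_or_nonempty with he | hne
    · exact ⟨f x - 1, by linarith, by simp [he]⟩
    · obtain ⟨z, hz, hmax⟩ := hfr.exists_isMaxOn hne hf.continuousOn
      refine ⟨f z, hLs (hLc.isClosed.frontier_subset hz) fun hzx => ?_, fun w hw => hmax hw⟩
      have hzx : z = x := hzx
      exact hz.2 (hzx ▸ hxi)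
  refine ⟨interior L, isOpen_interior.mem_nhds hxi, c', hc', fun a b p ha hp t ht => ?_⟩
  obtain ⟨_, ⟨s, rfl⟩, hs⟩ := IsPreconnected.inter_frontier_nonempty' (L := L)
    (isPreconnected_range p.continuous) ⟨p t, ⟨t, rfl⟩, ht⟩ ⟨p 0, ⟨0, rfl⟩, fun h0 => by
      rw [hLc.isClosed.closure_eq, p.source] at h0
      exact absurd (hle a h0) (not_le.2 ha)⟩
  exact absurd (hc'' _ hs) (not_le.2 (hp s))

/-- The part of the band outside `U` is compact and misses level `c`, so `f` is bounded there by a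
value below `c`. -/
lemma exists_level_subset_of_isCompact (hf : Continuous f) {c c0 : ℝ} (hc : c0 < c)
    (hK : IsCompact (f ⁻¹' Icc c0 c)) {U : Set Y} (hU : IsOpen U) (hcU : f ⁻¹' {c} ⊆ U) :
    ∃ c1 < c, c0 ≤ c1 ∧ f ⁻¹' Icc c1 c ⊆ U := by
  rcases (f ⁻¹' Icc c0 c \ U).eq_empty_or_nonempty with he | hne
  · exact ⟨c0, hc, le_rfl, sdiff_eq_empty.1 he⟩
  · obtain ⟨z, hz, hmax⟩ := (hK.diff hU).exists_isMaxOn hne hf.continuousOn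
    have hzc : f z < c := lt_of_le_of_ne hz.1.2 fun h => hz.2 (hcU h)
    refine ⟨(f z + c) / 2, by linarith, by linarith [hz.1.1], fun w hw => ?_⟩
    by_contra hwU
    have h1 := hz.1.1
    have h2 := hw.1
    have : f w ≤ f z := hmax ⟨⟨by linarith, hw.2⟩, hwU⟩
    linarith

end Topological

/-! ### Raising paths past one level, then past all levels -/

section Metric

variable {Y : Type*} [MetricSpace Y] {f : Y → ℝ}

/-- Both alternatives survive shrinking the ball and increasing `c'`, so the choices made near
single points combine over the compact level set. -/
lemma exists_uniform_radius [LocallyCompactSpace Y] (hf : Continuous f)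
    (hY : LocallyUniqueHomotopy Y) {c : ℝ} (hK : IsCompact (f ⁻¹' {c}))
    (hr : ∀ y, f y = c → RaisableAt f y) :
    ∃ c' < c, ∃ r > 0, ∃ U, IsOpen U ∧ f ⁻¹' {c} ⊆ U ∧ ∀ y ∈ U,
      UniquelyRaises f c (Metric.ball y r) ∨ Unreachable f c c' (Metric.ball y r) := by
  refine hK.induction_on (p := fun S => ∃ c' < c, ∃ r > 0, ∃ U, IsOpen U ∧ S ⊆ U ∧ ∀ y ∈ U,
      UniquelyRaises f c (Metric.ball y r) ∨ Unreachable f c c' (Metric.ball y r)) ?_ ?_ ?_ ?_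
  · exact ⟨c - 1, by linarith, 1, one_pos, ∅, isOpen_empty, Subset.rfl, by simp⟩
  · rintro s t hst ⟨c', hc', r, hr, U, hU, htU, h⟩
    exact ⟨c', hc', r, hr, U, hU, hst.trans htU, h⟩
  · rintro s t ⟨c', hc', r, hr, U, hU, hsU, h⟩ ⟨d', hd', r', hr', U', hU', htU', h'⟩
    refine ⟨max c' d', max_lt hc' hd', min r r', lt_min hr hr', U ∪ U', hU.union hU',
      union_subset_union hsU htU', ?_⟩
    rintro y (hy | hy)
    · exact (h y hy).imp (fun h => h.mono (Metric.ball_subset_ball (min_le_left _ _)))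
        (fun h => h.mono (Metric.ball_subset_ball (min_le_left _ _)) (le_max_left _ _))
    · exact (h' y hy).imp (fun h => h.mono (Metric.ball_subset_ball (min_le_right _ _)))
        (fun h => h.mono (Metric.ball_subset_ball (min_le_right _ _)) (le_max_right _ _))
  · intro x hx
    have hx : f x = c := hx
    obtain ⟨O, hO, c', hc', h⟩ : ∃ O ∈ 𝓝 x, ∃ c' < c,
        UniquelyRaises f c O ∨ Unreachable f c c' O := by
      subst hx
      rcases hr x rfl with ⟨-, h⟩ | h
      · obtain ⟨O, hO, h⟩ := h.exists_uniquelyRaises hY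
        exact ⟨O, hO, f x - 1, by linarith, Or.inl h⟩
      · obtain ⟨O, hO, c', hc', h⟩ := exists_unreachable hf h
        exact ⟨O, hO, c', hc', Or.inr h⟩
    obtain ⟨r, hr, hrO⟩ := Metric.mem_nhds_iff.1 hO
    refine ⟨Metric.ball x (r / 2),
      mem_nhdsWithin_of_mem_nhds (Metric.ball_mem_nhds x (by linarith)),
      c', hc', r / 2, by linarith, Metric.ball x (r / 2), Metric.isOpen_ball, Subset.rfl,
      fun y hy => ?_⟩
    have hsub : Metric.ball y (r / 2) ⊆ O := (Metric.ball_subset_ball' (by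
      have := Metric.mem_ball.1 hy
      linarith)).trans hrO
    exact h.imp (fun h => h.mono hsub) (fun h => h.mono hsub le_rfl)

/-- Points at level about `c` that are reachable from above level `c` can be joined to points above
level `c` by short paths. -/
lemma exists_short_escape [LocallyCompactSpace Y] [LocallyPathConnectedSpace Y] (hf : Continuous f)
    {c c1 r : ℝ} (hc1 : c1 < c) (hr0 : 0 < r) (hK : IsCompact (f ⁻¹' {c}))
    (hr : ∀ y, f y = c → RaisableAt f y) :
    ∃ c' < c, ∃ U, IsOpen U ∧ f ⁻¹' {c} ⊆ U ∧ ∀ (a b : Y) (p : Path a b), c < f a →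
      (∀ t, c' < f (p t)) → ∀ t, p t ∈ U →
        ∃ q, c < f q ∧ JoinedIn (Metric.ball (p t) r ∩ {z | c1 < f z}) (p t) q := by
  refine hK.induction_on (p := fun S => ∃ c' < c, ∃ U, IsOpen U ∧ S ⊆ U ∧
    ∀ (a b : Y) (p : Path a b), c < f a → (∀ t, c' < f (p t)) → ∀ t, p t ∈ U →
        ∃ q, c < f q ∧ JoinedIn (Metric.ball (p t) r ∩ {z | c1 < f z}) (p t) q) ?_ ?_ ?_ ?_
  · exact ⟨c - 1, by linarith, ∅, isOpen_empty, Subset.rfl, by simp⟩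
  · rintro s t hst ⟨c', hc', U, hU, htU, h⟩
    exact ⟨c', hc', U, hU, hst.trans htU, h⟩
  · rintro s t ⟨c', hc', U, hU, hsU, h⟩ ⟨d', hd', U', hU', htU', h'⟩
    refine ⟨max c' d', max_lt hc' hd', U ∪ U', hU.union hU',
      union_subset_union hsU htU', ?_⟩
    rintro a b p ha hp t (ht | ht)
    · exact h a b p ha (fun t => (le_max_left _ _).trans_lt (hp t)) t ht
    · exact h' a b p ha (fun t => (le_max_right _ _).trans_lt (hp t)) t ht
  · intro x hx
    have hx : f x = c := hx
    -- If `x` is not a local maximum, every small path-connected neighborhood contains a point above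
    -- level `c`. Near a strict local maximum the claim is vacuous, since the path never comes
    -- there.
    rcases hr x hx with ⟨h, -⟩ | h
    · have hV : Metric.ball x (r / 2) ∩ {z | c1 < f z} ∈ 𝓝 x :=
        inter_mem (Metric.ball_mem_nhds x (by linarith))
          ((isOpen_lt continuous_const hf).mem_nhds (by simpa [hx] using hc1))
      obtain ⟨M, ⟨hMo, hxM, hM⟩, hMV⟩ := (isOpen_isPathConnected_basis x).mem_iff.1 hV
      obtain ⟨q, hq, hqM⟩ := (h.and_eventually (hMo.mem_nhds hxM)).exists
      refine ⟨M, mem_nhdsWithin_of_mem_nhds (hMo.mem_nhds hxM), c1, hc1, M, hMo, Subset.rfl,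
        fun a b p _ _ t ht => ⟨q, hx ▸ hq, (hM.joinedIn _ ht _ hqM).mono fun z hz => ?_⟩⟩
      refine ⟨?_, (hMV hz).2⟩
      have h1 := Metric.mem_ball.1 (hMV hz).1
      have h2 := Metric.mem_ball.1 (hMV ht).1
      rw [Metric.mem_ball]
      have := dist_triangle_right z (p t) x
      linarith
    · obtain ⟨O, hO, c', hc', h⟩ := exists_unreachable hf h
      rw [hx] at hc' h
      refine ⟨interior O, mem_nhdsWithin_of_mem_nhds (interior_mem_nhds.2 hO), c', hc', interior O,
        isOpen_interior, Subset.rfl, fun a b p ha hp t ht => ?_⟩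
      exact absurd (interior_subset ht) (h a b p ha hp t)

-- Going out along `e` and back cancels; this glues the raised pieces of a path that is cut at
-- escape paths.
open Path.Homotopic.Quotient in
lemma homotopic_of_step {x y z w v : Y} {s1 : Path x y} {s2 : Path y z} {s : Path x z}
    {e : Path y w} {e' : Path z v} {m : Path x w} {m' : Path w v}
    (hs : (s1.trans s2).Homotopic s) (hm : (s1.trans e).Homotopic m)
    (hm' : ((e.symm.trans s2).trans e').Homotopic m') :
    (s.trans e').Homotopic (m.trans m') := by
  rw [← Path.Homotopic.Quotient.eq] at *
  simp only [mk_trans, mk_symm] at *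
  rw [← hs, ← hm, ← hm']
  simp only [trans_assoc]
  rw [← trans_assoc (mk e), trans_symm, refl_trans]

/-- Paths slightly below level `c` with endpoints above `c` can be pushed above level `c`. -/
theorem exists_raise_level [LocallyCompactSpace Y] [LocallyPathConnectedSpace Y] (hf : Continuous f)
    (hY : LocallyUniqueHomotopy Y) {c c0 : ℝ} (hc : c0 < c) (hK : IsCompact (f ⁻¹' Icc c0 c))
    (hr : ∀ y, f y = c → RaisableAt f y) :
    ∃ c' < c, ∀ (a b : Y) (p : Path a b), c < f a → c < f b → (∀ t, c' < f (p t)) →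
      ∃ q : Path a b, (∀ t, c < f (q t)) ∧ p.Homotopic q := by
  have hKc : IsCompact (f ⁻¹' {c}) := hK.of_isClosed_subset (isClosed_singleton.preimage hf)
    (preimage_mono (by simp [hc.le]))
  obtain ⟨c', hc', r, hr0, U, hU, hcU, hball⟩ := exists_uniform_radius hf hY hKc hr
  obtain ⟨c1, hc1, -, hc1U⟩ := exists_level_subset_of_isCompact hf hc hK hU hcU
  obtain ⟨c2, hc2, U2, hU2, hcU2, hesc⟩ := exists_short_escape hf hc1
    (show 0 < r / 4 by linarith) hKc hr
  obtain ⟨c3, hc3, -, hc3U⟩ := exists_level_subset_of_isCompact hf hc hK hU2 hcU2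
  -- `c'` keeps the path away from strict maxima, `c1` and `c3` put points at or below level `c`
  -- into `U` and `U2`, and `c2` makes short escapes available.
  refine ⟨max (max c' c1) (max c2 c3), by simp [*], fun a b p ha hb hp => ?_⟩
  have hp' : ∀ t, c' < f (p t) ∧ c1 < f (p t) ∧ c2 < f (p t) ∧ c3 < f (p t) := fun t => by
    have := hp t
    simp only [max_lt_iff] at this
    tauto
  have hgood : ∀ t, ∃ q, c < f q ∧
      JoinedIn (Metric.ball (p t) (r / 4) ∩ {z | c1 < f z}) (p t) q := fun t => by
    by_cases ht : c < f (p t)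
    · exact ⟨p t, ht, JoinedIn.refl ⟨Metric.mem_ball_self (by linarith), (hp' t).2.1⟩⟩
    · exact hesc a b p ha (fun t => (hp' t).2.2.1) t (hc3U ⟨(hp' t).2.2.2.le, not_lt.1 ht⟩)
  obtain ⟨ρ, hρ, huc⟩ := Metric.uniformContinuous_iff.1
    (CompactSpace.uniformContinuous_of_continuous p.continuous) (r / 4) (by linarith)
  have hstep : ∀ (t t' : unitInterval), dist t t' < ρ → ∀ (q q' : Y) (e : Path (p t) q)
      (e' : Path (p t') q'), c < f q → c < f q' →
      (∀ s, e s ∈ Metric.ball (p t) (r / 4) ∩ {z | c1 < f z}) →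
      (∀ s, e' s ∈ Metric.ball (p t') (r / 4) ∩ {z | c1 < f z}) →
      ∃ m : Path q q', (∀ s, c < f (m s)) ∧
        ((e.symm.trans (p.subpath t t')).trans e').Homotopic m := by
    intro t t' htt q q' e e' hq hq' he he'
    set σ := (e.symm.trans (p.subpath t t')).trans e' with hσ
    by_cases hall : ∀ s, c < f (σ s)
    · exact ⟨σ, hall, .refl _⟩
    -- The two escape paths and the piece of `p` each contribute at most `r / 4`, so `σ` stays
    -- within `r / 2` of `p t` and has diameter less than `r`.
    have hrange : ∀ z ∈ range σ, dist z (p t) < r / 2 ∧ c1 < f z := by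
      intro z hz
      rw [hσ, Path.trans_range, Path.trans_range, Path.symm_range, Path.range_subpath] at hz
      rcases hz with (⟨s, rfl⟩ | ⟨s, hs, rfl⟩) | ⟨s, rfl⟩
      · have := Metric.mem_ball.1 (he s).1
        exact ⟨by linarith, (he s).2⟩
      · refine ⟨?_, (hp' s).2.1⟩
        have : dist (p s) (p t) < r / 4 := by
          apply huc
          refine lt_of_le_of_lt ?_ htt
          rw [dist_comm t t']
          have h1 := Set.abs_sub_left_of_mem_uIcc (a := (t : ℝ)) (b := t') (c := s) (by
            rcases le_total t t' with h | h
            · rw [uIcc_of_le h] at hs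
              rw [uIcc_of_le (by exact_mod_cast h)]
              exact ⟨hs.1, hs.2⟩
            · rw [uIcc_of_ge h] at hs
              rw [uIcc_of_ge (by exact_mod_cast h)]
              exact ⟨hs.1, hs.2⟩)
          simpa [Subtype.dist_eq, Real.dist_eq] using h1
        linarith
      · have h1 := Metric.mem_ball.1 (he' s).1
        have h2 := huc (show dist t' t < ρ by rwa [dist_comm])
        have := dist_triangle (e' s) (p t') (p t)
        exact ⟨by linarith, (he' s).2⟩
    push Not at hall
    obtain ⟨s, hs⟩ := hall
    have hsσ := hrange (σ s) ⟨s, rfl⟩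
    have hsub : range σ ⊆ Metric.ball (σ s) r := fun z hz => by
      have h1 := (hrange z hz).1
      have := dist_triangle_right z (σ s) (p t)
      rw [Metric.mem_ball]
      linarith
    rcases hball (σ s) (hc1U ⟨hsσ.2.le, hs⟩) with h | h
    · exact h _ _ σ hq hq' hsub
    -- The ball about `σ s` contains `p t`, a point of the path, so it is not unreachable.
    · refine absurd ?_ (h a b p ha (fun t => (hp' t).1) t)
      rw [Metric.mem_ball, dist_comm]
      linarith
  -- Quantifying over all escape paths `e` lets the step to `t'` end with an arbitrary one. The step
  -- size `ρ` is uniform, so `T` is clopen; at time `1` the constant escape path gives the claim.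
  let T : Set unitInterval := {t | ∀ (q : Y) (e : Path (p t) q), c < f q →
      (∀ s, e s ∈ Metric.ball (p t) (r / 4) ∩ {z | c1 < f z}) →
      ∃ m : Path (p 0) q, (∀ s, c < f (m s)) ∧ ((p.subpath 0 t).trans e).Homotopic m}
  have hTstep : ∀ t t', t ∈ T → dist t t' < ρ → t' ∈ T := by
    intro t t' ht htt q' e' hq' he'
    obtain ⟨q, hq, hj⟩ := hgood t
    obtain ⟨m, hm, hm'⟩ := ht q hj.somePath hq hj.somePath_mem
    obtain ⟨μ, hμ, hμ'⟩ := hstep t t' htt q q' hj.somePath e' hq hq' hj.somePath_mem he'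
    refine ⟨m.trans μ, fun s => ?_,
      homotopic_of_step ⟨Path.Homotopy.subpathTransSubpath p 0 t t'⟩ hm' hμ'⟩
    have : (m.trans μ) s ∈ range m ∪ range μ := by
      rw [← Path.trans_range]
      exact ⟨s, rfl⟩
    rcases this with ⟨s', hs'⟩ | ⟨s', hs'⟩
    · rw [← hs']; exact hm s'
    · rw [← hs']; exact hμ s'
  have h0 : (0 : unitInterval) ∈ T := by
    intro q e hq he
    have hp0 : c < f (p 0) := by rwa [p.source]
    obtain ⟨m, hm, hm'⟩ := hstep 0 0 (by simpa using hρ) (p 0) q (Path.refl _) e hp0 hq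
      (fun s => ⟨Metric.mem_ball_self (by linarith), hc1.trans hp0⟩) he
    refine ⟨m, hm, ?_⟩
    have h2 : ((Path.refl (p 0)).symm.trans (p.subpath 0 0)).Homotopic (p.subpath 0 0) := by
      rw [Path.refl_symm]
      exact ⟨Path.Homotopy.reflTrans _⟩
    exact (h2.hcomp (.refl e)).symm.trans hm'
  have hTuniv : T = univ := by
    refine IsClopen.eq_univ ⟨⟨?_⟩, ?_⟩ ⟨0, h0⟩
    · refine Metric.isOpen_iff.2 fun t ht => ⟨ρ, hρ, fun t' ht' h => ht (hTstep t' t h ht')⟩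
    · refine Metric.isOpen_iff.2 fun t ht => ⟨ρ, hρ, fun t' ht' => hTstep t t' ht ?_⟩
      rwa [dist_comm]
  have hp1 : c < f (p 1) := by rwa [p.target]
  obtain ⟨m, hm, hm'⟩ := (hTuniv ▸ mem_univ 1 : (1 : unitInterval) ∈ T) (p 1) (Path.refl _) hp1
    (fun s => ⟨Metric.mem_ball_self (by linarith), hc1.trans hp1⟩)
  refine ⟨m.cast p.source.symm p.target.symm, hm, ?_⟩
  have h3 : (p.subpath 0 1).Homotopic m :=
    Path.Homotopic.trans (Path.Homotopic.symm ⟨Path.Homotopy.transRefl _⟩) hm'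
  rw [Path.subpath_zero_one] at h3
  exact h3.pathCast p.source.symm p.target.symm

/-- A path with endpoints above level `b` can be pushed above level `b`. -/
theorem exists_raise [LocallyCompactSpace Y] [LocallyPathConnectedSpace Y] (hf : Continuous f)
    (hY : LocallyUniqueHomotopy Y) {s : ℝ} (hs : ∀ y, s < f y)
    (hK : ∀ c0 c1, s < c0 → IsCompact (f ⁻¹' Icc c0 c1)) (hr : ∀ y, RaisableAt f y)
    {x y : Y} {b : ℝ} (hx : b < f x) (hy : b < f y) (p : Path x y) :
    ∃ q : Path x y, (∀ t, b < f (q t)) ∧ p.Homotopic q := by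
  let A : Set ℝ := {c | ∃ q : Path x y, (∀ t, c < f (q t)) ∧ p.Homotopic q}
  have hdown : ∀ c ∈ A, ∀ d ≤ c, d ∈ A := fun c ⟨q, hq, hpq⟩ d hd =>
    ⟨q, fun t => hd.trans_lt (hq t), hpq⟩
  -- `f` attains its minimum on a path, so a path above `c` is also above a slightly larger level;
  -- thus `A` has no greatest element.
  have hup : ∀ c ∈ A, ∃ d ∈ A, c < d := by
    rintro c ⟨q, hq, hpq⟩
    obtain ⟨t, -, ht⟩ := isCompact_univ.exists_isMinOn ⟨(0 : unitInterval), mem_univ _⟩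
      (hf.comp q.continuous).continuousOn
    refine ⟨(c + f (q t)) / 2, ⟨q, fun t' => ?_, hpq⟩, by linarith [hq t]⟩
    have : f (q t) ≤ f (q t') := ht (mem_univ t')
    linarith [hq t]
  by_contra hb
  have hb : b ∉ A := hb
  have hbdd : ∀ c ∈ A, c ≤ b := fun c hc => le_of_not_ge fun h => hb (hdown c hc b h)
  have hsA : s ∈ A := ⟨p, fun t => hs _, .refl _⟩
  have hlub : IsLUB A (sSup A) := isLUB_csSup ⟨s, hsA⟩ ⟨b, hbdd⟩
  set c := sSup A
  obtain ⟨d, hd, hsd⟩ := hup s hsA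
  have hsc : s < c := hsd.trans_le (hlub.1 hd)
  have hcb : c ≤ b := hlub.2 hbdd
  -- Bands are compact only above `s`, hence the lower end halfway between `s` and `c`. Some path
  -- already lies above `c'`, so raising it past `c` puts the supremum `c` into `A`.
  obtain ⟨c', hc', hraise⟩ := exists_raise_level hf hY (show (s + c) / 2 < c by linarith)
    (hK _ c (by linarith)) (fun y _ => hr y)
  obtain ⟨e, he, hce⟩ : ∃ e ∈ A, c' < e := by
    by_contra h
    push Not at h
    exact absurd (hlub.2 h) (not_le.2 hc')
  obtain ⟨q, hq, hpq⟩ := he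
  obtain ⟨q', hq', hqq'⟩ := hraise x y q (hcb.trans_lt hx) (hcb.trans_lt hy)
    fun t => hce.trans (hq t)
  obtain ⟨g, hg, hcg⟩ := hup c ⟨q', hq', hpq.trans hqq'⟩
  exact absurd (hlub.1 hg) (not_le.2 hcg)

end Metric

/-! ### Transfer along local homeomorphisms -/

lemma RaisableAt.of_openPartialHomeomorph {Y Z : Type*} [TopologicalSpace Y] [TopologicalSpace Z]
    (e : OpenPartialHomeomorph Y Z) {f : Y → ℝ} {g : Z → ℝ} {x : Y} (hx : x ∈ e.source)
    (hfg : ∀ y ∈ e.source, f y = g (e y)) (h : RaisableAt g (e x)) : RaisableAt f x := by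
  have hsrc : ∀ᶠ y in 𝓝 x, y ∈ e.source := e.open_source.mem_nhds hx
  rcases h with ⟨h1, h2⟩ | h
  · left
    constructor
    · rw [← e.map_nhds_eq hx, frequently_map] at h1
      refine (h1.and_eventually hsrc).mono fun y hy => ?_
      rw [hfg x hx, hfg y hy.2]
      exact hy.1
    · intro V hV
      have hV' : e.target ∩ e.symm ⁻¹' V ∈ 𝓝 (e x) := by
        refine inter_mem (e.open_target.mem_nhds (e.map_source hx)) ?_
        exact (e.continuousAt_symm (e.map_source hx)).preimage_mem_nhds (by rwa [e.left_inv hx])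
      obtain ⟨N, hN, hj⟩ := h2 _ hV'
      refine ⟨e.source ∩ e ⁻¹' N, inter_mem hsrc ((e.continuousAt hx).preimage_mem_nhds hN), ?_⟩
      rintro a ⟨ha, haN⟩ b ⟨hb, hbN⟩ hfa hfb
      rw [hfg x hx, hfg a ha] at hfa
      rw [hfg x hx, hfg b hb] at hfb
      have := (hj _ haN _ hbN hfa hfb).map_continuousOn (f := e.symm)
        (e.continuousOn_symm.mono fun z hz => hz.1.1)
      rw [e.left_inv ha, e.left_inv hb] at this
      refine this.mono ?_
      rintro _ ⟨z, ⟨⟨hzt, hzV⟩, hz⟩, rfl⟩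
      refine ⟨hzV, ?_⟩
      have hz : g (e x) < g z := hz
      show f x < f (e.symm z)
      rwa [hfg x hx, hfg _ (e.map_target hzt), e.right_inv hzt]
  · right
    rw [eventually_nhdsWithin_iff] at h ⊢
    filter_upwards [(e.continuousAt hx).eventually h, hsrc] with y hy hys hyx
    rw [hfg x hx, hfg y hys]
    exact hy fun hxy => hyx (e.injOn hys hx hxy)

/-! ### Regular points -/

lemma le_of_deriv_nonneg_along {E : Type*} [NormedAddCommGroup E] [NormedSpace ℝ E] {g : E → ℝ}
    {g' : E → E →L[ℝ] ℝ} {a v : E} {τ : ℝ}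
    (h : ∀ s ∈ Icc 0 τ, HasFDerivAt g (g' (a + s • v)) (a + s • v) ∧ 0 ≤ g' (a + s • v) v) :
    ∀ s ∈ Icc 0 τ, g a ≤ g (a + s • v) := by
  have hd : ∀ s ∈ Icc 0 τ, HasDerivAt (fun s : ℝ => g (a + s • v)) (g' (a + s • v) v) s := by
    intro s hs
    have h1 : HasDerivAt (fun s : ℝ => a + s • v) v s := by
      simpa using ((hasDerivAt_id s).smul_const v).const_add a
    exact (h s hs).1.comp_hasDerivAt s h1
  have hm : MonotoneOn (fun s : ℝ => g (a + s • v)) (Icc 0 τ) := by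
    refine monotoneOn_of_deriv_nonneg (convex_Icc 0 τ)
      (fun s hs => (hd s hs).continuousAt.continuousWithinAt)
      (fun s hs => (hd s (interior_subset hs)).differentiableAt.differentiableWithinAt)
      fun s hs => ?_
    rw [(hd s (interior_subset hs)).deriv]
    exact (h s (interior_subset hs)).2
  intro s hs
  simpa using hm ⟨le_rfl, hs.1.trans hs.2⟩ hs hs.1

lemma joinedIn_of_segment_subset {E : Type*} [NormedAddCommGroup E] [NormedSpace ℝ E] {S : Set E}
    {a b : E} (h : ∀ s ∈ Icc (0 : ℝ) 1, a + s • (b - a) ∈ S) : JoinedIn S a b := by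
  refine JoinedIn.ofLine (f := fun s : ℝ => a + s • (b - a)) (by fun_prop) (by simp) (by simp) ?_
  rintro _ ⟨s, hs, rfl⟩
  exact h s hs

/-- Choose `v` on which the derivative is positive near `x`. Translating by `τ • v` raises `g` and
carries a small ball into the region above the level; there the translated points are joined by a
segment. -/
lemma raisableAt_of_fderiv_ne_zero {E : Type*} [NormedAddCommGroup E] [NormedSpace ℝ E] {g : E → ℝ}
    {g' : E → E →L[ℝ] ℝ} {x : E} (hg : ∀ᶠ y in 𝓝 x, HasFDerivAt g (g' y) y)
    (hg' : ContinuousAt g' x) (h0 : g' x ≠ 0) : RaisableAt g x := by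
  left
  refine ⟨fun h => h0 ?_, ?_⟩
  · have : IsLocalMax g x := h.mono fun y hy => not_lt.1 hy
    exact this.hasFDerivAt_eq_zero hg.self_of_nhds
  intro V hV
  obtain ⟨v, hv⟩ : ∃ v, 0 < g' x v := by
    obtain ⟨v, hv⟩ : ∃ v, g' x v ≠ 0 := by
      by_contra h
      push Not at h
      exact h0 (ContinuousLinearMap.ext h)
    rcases lt_or_gt_of_ne hv with h | h
    · exact ⟨-v, by simpa using h⟩
    · exact ⟨v, h⟩
  have hpos : ∀ᶠ y in 𝓝 x, 0 < g' y v :=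
    (hg'.clm_apply continuousAt_const).eventually (lt_mem_nhds hv)
  obtain ⟨r, hr, hball⟩ := Metric.eventually_nhds_iff_ball.1 ((hg.and hpos).and hV)
  -- a point above the level of `x` on the line through `x` in the direction `v`
  obtain ⟨τ, hτ, hτr, hxτ⟩ : ∃ τ > 0, τ * ‖v‖ < r / 2 ∧ g x < g (x + τ • v) := by
    have hd : HasDerivAt (fun s : ℝ => g (x + s • v)) (g' x v) 0 := by
      have h1 : HasDerivAt (fun s : ℝ => x + s • v) v 0 := by
        simpa using ((hasDerivAt_id (0 : ℝ)).smul_const v).const_add x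
      have h2 : HasFDerivAt g (g' x) (x + (0 : ℝ) • v) := by
        simpa using hg.self_of_nhds
      exact h2.comp_hasDerivAt 0 h1
    have hsl := (hasDerivAt_iff_tendsto_slope.1 hd).eventually (lt_mem_nhds hv)
    have hsl' : ∀ᶠ s in 𝓝[>] (0 : ℝ), 0 < slope (fun s : ℝ => g (x + s • v)) 0 s :=
      hsl.filter_mono (nhdsWithin_mono _ fun s (hs : 0 < s) => hs.ne')
    have hsm : ∀ᶠ s in 𝓝[>] (0 : ℝ), s * ‖v‖ < r / 2 := by
      have : Tendsto (fun s : ℝ => s * ‖v‖) (𝓝[>] 0) (𝓝 (0 * ‖v‖)) :=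
        (tendsto_id.mul_const _).mono_left nhdsWithin_le_nhds
      refine this.eventually (gt_mem_nhds ?_)
      simpa using hr
    obtain ⟨τ, ⟨h1, h2⟩, h3⟩ := ((hsl'.and hsm).and self_mem_nhdsWithin).exists
    have h3 : 0 < τ := h3
    refine ⟨τ, h3, h2, ?_⟩
    rw [slope_def_field, div_pos_iff_of_pos_right (by simpa using h3)] at h1
    simpa using h1
  have hxτr : x + τ • v ∈ Metric.ball x r := by
    rw [Metric.mem_ball, dist_eq_norm, add_sub_cancel_left, norm_smul, Real.norm_of_nonneg hτ.le]
    linarith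
  obtain ⟨r', hr', hball'⟩ := Metric.eventually_nhds_iff_ball.1
    ((hball _ hxτr).1.1.continuousAt.eventually (lt_mem_nhds hxτ))
  set ρ := min r' (r / 2)
  have hρ : 0 < ρ := lt_min hr' (by linarith)
  have hin : ∀ a ∈ Metric.ball x ρ, ∀ s ∈ Icc 0 τ, a + s • v ∈ Metric.ball x r := by
    intro a ha s hs
    have h1 : dist a x < r / 2 := (Metric.mem_ball.1 ha).trans_le (min_le_right _ _)
    have h2 : ‖s • v‖ < r / 2 := by
      rw [norm_smul, Real.norm_of_nonneg hs.1]
      exact (mul_le_mul_of_nonneg_right hs.2 (norm_nonneg v)).trans_lt hτr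
    rw [Metric.mem_ball, dist_eq_norm] at *
    have : a + s • v - x = (a - x) + s • v := by abel
    rw [this]
    exact (norm_add_le _ _).trans_lt (by linarith)
  have hup : ∀ a ∈ Metric.ball x ρ, g x < g a →
      JoinedIn (V ∩ {z | g x < g z}) a (a + τ • v) := by
    intro a ha hga
    have hmono := le_of_deriv_nonneg_along (g := g) (g' := g') (a := a) (v := v) (τ := τ)
      fun s hs => ⟨(hball _ (hin a ha s hs)).1.1, (hball _ (hin a ha s hs)).1.2.le⟩
    refine joinedIn_of_segment_subset fun s hs => ?_
    have hs' : s * τ ∈ Icc 0 τ := ⟨mul_nonneg hs.1 hτ.le, by nlinarith [hs.2]⟩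
    rw [add_sub_cancel_left, smul_smul]
    exact ⟨(hball _ (hin a ha _ hs')).2, hga.trans_le (hmono _ hs')⟩
  refine ⟨Metric.ball x ρ, Metric.ball_mem_nhds x hρ, fun a ha b hb hga hgb => ?_⟩
  refine ((hup a ha hga).trans ?_).trans (hup b hb hgb).symm
  refine joinedIn_of_segment_subset fun s hs => ?_
  have hc : a + s • (b - a) ∈ Metric.ball x ρ := by
    have := (convex_ball x ρ).add_smul_sub_mem ha hb hs
    exact this
  have heq : a + τ • v + s • (b + τ • v - (a + τ • v)) = (a + s • (b - a)) + τ • v := by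
    rw [add_sub_add_right_eq_sub]
    abel
  rw [heq]
  refine ⟨(hball _ (hin _ hc τ ⟨hτ.le, le_rfl⟩)).2, hball' _ ?_⟩
  rw [Metric.mem_ball, dist_add_right]
  exact (Metric.mem_ball.1 hc).trans_le (min_le_left _ _)

/-! ### Nondegenerate critical points -/

section Quadratic

open scoped InnerProductSpace

variable {F : Type*} [NormedAddCommGroup F] [InnerProductSpace ℝ F]

/-- Move along the sphere through `u`, which is connected in dimension greater than one, then
radially. -/
lemma joinedIn_punctured_ball (h : 1 < Module.rank ℝ F) {R : ℝ} {u v : F} (hu : u ≠ 0) (hv : v ≠ 0)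
    (huR : ‖u‖ < R) (hvR : ‖v‖ < R) : JoinedIn {z : F | z ≠ 0 ∧ ‖z‖ < R} u v := by
  have hu' : 0 < ‖u‖ := norm_pos_iff.2 hu
  have hv' : 0 < ‖v‖ := norm_pos_iff.2 hv
  have h1 : JoinedIn (Metric.sphere (0 : F) ‖u‖) u ((‖u‖ / ‖v‖) • v) := by
    refine (isPathConnected_sphere h 0 hu'.le).joinedIn _ (by simp) _ ?_
    simp [norm_smul, hv'.ne']
  refine (h1.mono fun z hz => ?_).trans (joinedIn_of_segment_subset fun s hs => ?_)
  · have hz : ‖z‖ = ‖u‖ := by simpa using hz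
    exact ⟨norm_pos_iff.1 (hz ▸ hu'), hz ▸ huR⟩
  · have heq : (‖u‖ / ‖v‖) • v + s • (v - (‖u‖ / ‖v‖) • v)
        = ((1 - s) * (‖u‖ / ‖v‖) + s) • v := by module
    have hpos : 0 < (1 - s) * (‖u‖ / ‖v‖) + s := by
      have : 0 < ‖u‖ / ‖v‖ := by positivity
      rcases hs.2.lt_or_eq with h | h
      · have := mul_pos (sub_pos.2 h) this
        linarith [hs.1]
      · rw [h]; simp
    rw [heq]
    refine ⟨smul_ne_zero hpos.ne' hv, ?_⟩
    rw [norm_smul, Real.norm_of_nonneg hpos.le, add_mul, mul_assoc, div_mul_cancel₀ _ hv'.ne']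
    rcases hs.2.lt_or_eq with h | h
    · nlinarith [hs.1]
    · rw [h]; simpa using hvR

/-- `g` is approximated near `0`, to first order in the derivative, by the quadratic function which
is half the square of the norm on `P` and minus half the square of the norm on `Pᗮ`. -/
def ApproxSplit (g : F → ℝ) (g' : F → F →L[ℝ] ℝ) (P : Submodule ℝ F) (ρ : ℝ) : Prop :=
  ∀ p ∈ P, ∀ m ∈ Pᗮ, ‖p + m‖ < ρ → HasFDerivAt g (g' (p + m)) (p + m) ∧
    ∀ v, |g' (p + m) v - (⟪p, v⟫_ℝ - ⟪m, v⟫_ℝ)| ≤ 1 / 16 * ‖p + m‖ * ‖v‖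

variable {g : F → ℝ} {g' : F → F →L[ℝ] ℝ} {P : Submodule ℝ F} {ρ : ℝ}

lemma norm_add_sq_of_mem_orthogonal {p m : F} (hp : p ∈ P) (hm : m ∈ Pᗮ) :
    ‖p + m‖ ^ 2 = ‖p‖ ^ 2 + ‖m‖ ^ 2 := by
  rw [norm_add_sq_real, hm p hp]
  ring

/-- The bound on the derivative is integrated along the segment from `0` to `p + m`. -/
lemma ApproxSplit.abs_sub_le (h : ApproxSplit g g' P ρ) {p m : F} (hp : p ∈ P) (hm : m ∈ Pᗮ)
    (hpm : ‖p + m‖ < ρ) :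
    |g (p + m) - g 0 - (‖p‖ ^ 2 - ‖m‖ ^ 2) / 2| ≤ 1 / 16 * (‖p‖ ^ 2 + ‖m‖ ^ 2) := by
  rw [← norm_add_sq_of_mem_orthogonal hp hm]
  have hsm : ∀ s ∈ Icc (0 : ℝ) 1, ‖s • p + s • m‖ = s * ‖p + m‖ := fun s hs => by
    rw [← smul_add, norm_smul, Real.norm_of_nonneg hs.1]
  have hs : ∀ s ∈ Icc (0 : ℝ) 1, _ := fun s hs => h (s • p) (P.smul_mem s hp) (s • m)
    (Pᗮ.smul_mem s hm) (by
      rw [hsm s hs]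
      have := norm_nonneg (p + m)
      nlinarith [hs.2])
  have hpm0 : ⟪p, m⟫_ℝ = 0 := hm p hp
  have hmp0 : ⟪m, p⟫_ℝ = 0 := by rw [real_inner_comm]; exact hpm0
  have key := norm_image_sub_le_of_norm_deriv_le_segment_01'
    (f := fun s : ℝ => g (s • p + s • m) - s ^ 2 * ((‖p‖ ^ 2 - ‖m‖ ^ 2) / 2))
    (f' := fun s => g' (s • p + s • m) (p + m) - s * (‖p‖ ^ 2 - ‖m‖ ^ 2))
    (C := 1 / 16 * ‖p + m‖ ^ 2) (fun s hs' => by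
      have h1 : HasDerivAt (fun s : ℝ => s • p + s • m) (p + m) s := by
        have := ((hasDerivAt_id s).smul_const p).add ((hasDerivAt_id s).smul_const m)
        rw [one_smul, one_smul] at this
        exact this
      have h2 := (hs s hs').1.comp_hasDerivAt s h1
      have h3 : HasDerivAt (fun s : ℝ => s ^ 2 * ((‖p‖ ^ 2 - ‖m‖ ^ 2) / 2))
          (s * (‖p‖ ^ 2 - ‖m‖ ^ 2)) s := by
        have := ((hasDerivAt_id s).pow 2).mul_const ((‖p‖ ^ 2 - ‖m‖ ^ 2) / 2)
        refine this.congr_deriv ?_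
        simp only [id, Nat.cast_ofNat, mul_one]
        ring
      exact (h2.sub h3).hasDerivWithinAt) (fun s hs' => by
      have hs'' : s ∈ Icc (0 : ℝ) 1 := ⟨hs'.1, hs'.2.le⟩
      have h1 := (hs s hs'').2 (p + m)
      rw [hsm s hs''] at h1
      have h2 : ⟪s • p, p + m⟫_ℝ - ⟪s • m, p + m⟫_ℝ = s * (‖p‖ ^ 2 - ‖m‖ ^ 2) := by
        simp only [real_inner_smul_left, inner_add_right, real_inner_self_eq_norm_sq, hpm0, hmp0]
        ring
      rw [h2] at h1
      rw [Real.norm_eq_abs]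
      refine h1.trans ?_
      nlinarith [sq_nonneg ‖p + m‖, hs'.2])
  have : |g (p + m) - (‖p‖ ^ 2 - ‖m‖ ^ 2) / 2 - g 0| ≤ 1 / 16 * ‖p + m‖ ^ 2 := by
    simpa using key
  rwa [sub_right_comm] at this

lemma ApproxSplit.lt_of_mem (h : ApproxSplit g g' P ρ) {p : F} (hp : p ∈ P) (hp0 : p ≠ 0)
    (hpρ : ‖p‖ < ρ) : g 0 < g p := by
  have := h.abs_sub_le hp (Pᗮ.zero_mem) (by simpa using hpρ)
  rw [add_zero, norm_zero] at this
  have hpos : 0 < ‖p‖ := norm_pos_iff.2 hp0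
  have := (abs_le.1 this).1
  nlinarith

lemma ApproxSplit.eventually_lt (h : ApproxSplit g g' ⊥ ρ) (hρ : 0 < ρ) :
    ∀ᶠ z in 𝓝[≠] 0, g z < g 0 := by
  rw [eventually_nhdsWithin_iff]
  filter_upwards [Metric.ball_mem_nhds (0 : F) hρ] with z hz hz0
  have hz : ‖z‖ < ρ := by simpa using hz
  have := h.abs_sub_le (p := 0) (m := z) (Submodule.zero_mem _) (by simp) (by simpa using hz)
  rw [zero_add, norm_zero] at this
  have hpos : 0 < ‖z‖ := norm_pos_iff.2 hz0
  have := (abs_le.1 this).2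
  nlinarith

/-- From a point above the level of the critical point, flow to `P` above that level. -/
lemma ApproxSplit.joinedIn (h : ApproxSplit g g' P ρ) {R : ℝ} (hRρ : R ≤ ρ) {p m : F} (hp : p ∈ P)
    (hm : m ∈ Pᗮ) (hpm : ‖p + m‖ < R / 4) (hg : g 0 < g (p + m)) :
    p ≠ 0 ∧ ‖(2 : ℝ) • p‖ < R ∧
      JoinedIn (Metric.ball 0 R ∩ {z | g 0 < g z}) (p + m) ((2 : ℝ) • p) := by
  have hsq := norm_add_sq_of_mem_orthogonal hp hm
  have hR : 0 < R := by have := norm_nonneg (p + m); linarith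
  have hval := (abs_le.1 (h.abs_sub_le hp hm (by linarith))).2
  -- Being above the critical level forces `7 * ‖m‖ ^ 2 < 9 * ‖p‖ ^ 2`; the factor `2` is a
  -- convenient weakening.
  have hm2 : ‖m‖ ^ 2 < 2 * ‖p‖ ^ 2 := by nlinarith [sq_nonneg ‖m‖, sq_nonneg ‖p‖]
  have hp0 : 0 < ‖p‖ := by
    by_contra hcon
    have : ‖p‖ = 0 := le_antisymm (not_lt.1 hcon) (norm_nonneg _)
    rw [this] at hm2
    nlinarith [sq_nonneg ‖m‖]
  have hple : ‖p‖ ≤ ‖p + m‖ := by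
    refine (sq_le_sq₀ (norm_nonneg _) (norm_nonneg _)).1 ?_
    nlinarith [sq_nonneg ‖m‖]
  have hmle : ‖m‖ ≤ ‖p + m‖ := by
    refine (sq_le_sq₀ (norm_nonneg _) (norm_nonneg _)).1 ?_
    nlinarith [sq_nonneg ‖p‖]
  have hmp : ‖m‖ ≤ 2 * ‖p‖ := by
    refine (sq_le_sq₀ (norm_nonneg _) (by positivity)).1 ?_
    nlinarith
  have hbound : ∀ s ∈ Icc (0 : ℝ) 2, ∀ u ∈ Icc (0 : ℝ) 1,
      ‖s • p + u • m‖ ≤ 2 * ‖p‖ + ‖m‖ ∧ ‖s • p + u • m‖ < R := by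
    intro s hs u hu
    have h1 := norm_add_le (s • p) (u • m)
    rw [norm_smul, norm_smul, Real.norm_of_nonneg hs.1, Real.norm_of_nonneg hu.1] at h1
    have h2 := mul_le_mul_of_nonneg_right hs.2 (norm_nonneg p)
    have h3 := mul_le_mul_of_nonneg_right hu.2 (norm_nonneg m)
    constructor <;> linarith
  refine ⟨norm_pos_iff.1 hp0, ?_, ?_⟩
  · simpa using (hbound 2 ⟨by norm_num, le_rfl⟩ 0 ⟨le_rfl, by norm_num⟩).2
  have hmono := le_of_deriv_nonneg_along (g := g) (g' := g') (a := p + m) (v := p) (τ := 1)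
    fun s hs => by
      have heq : p + m + s • p = (1 + s) • p + m := by module
      have hb := hbound (1 + s) ⟨by linarith [hs.1], by linarith [hs.2]⟩ 1 ⟨by norm_num, le_rfl⟩
      rw [one_smul] at hb
      obtain ⟨hd, hd'⟩ := h ((1 + s) • p) (P.smul_mem _ hp) m hm (by linarith)
      rw [heq]
      refine ⟨hd, ?_⟩
      have h1 := (abs_le.1 (hd' p)).1
      have h2 : ⟪m, p⟫_ℝ = 0 := by rw [real_inner_comm]; exact hm p hp
      rw [real_inner_smul_left, real_inner_self_eq_norm_sq, h2] at h1
      have h3 : ‖(1 + s) • p + m‖ * ‖p‖ ≤ (4 * ‖p‖) * ‖p‖ :=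
        mul_le_mul_of_nonneg_right (by linarith) hp0.le
      nlinarith [mul_nonneg hs.1 (sq_nonneg ‖p‖)]
  -- Doubling `p` does not decrease `g`, by the derivative estimate. It also makes the positive part
  -- dominate by enough that the value estimate alone keeps `g` above `g 0` while `m` shrinks to
  -- zero.
  refine JoinedIn.trans (y := (2 : ℝ) • p + m) ?_ ?_
  · refine joinedIn_of_segment_subset fun s hs => ?_
    have heq : p + m + s • ((2 : ℝ) • p + m - (p + m)) = p + m + s • p := by module
    rw [heq]
    refine ⟨?_, hg.trans_le (hmono s hs)⟩
    have heq : p + m + s • p = (1 + s) • p + (1 : ℝ) • m := by module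
    rw [mem_ball_zero_iff, heq]
    exact (hbound (1 + s) ⟨by linarith [hs.1], by linarith [hs.2]⟩ 1 ⟨by norm_num, le_rfl⟩).2
  · refine joinedIn_of_segment_subset fun s hs => ?_
    have heq : (2 : ℝ) • p + m + s • ((2 : ℝ) • p - ((2 : ℝ) • p + m))
        = (2 : ℝ) • p + (1 - s) • m := by module
    rw [heq]
    have hb := (hbound 2 ⟨by norm_num, le_rfl⟩ (1 - s) ⟨by linarith [hs.2], by linarith [hs.1]⟩).2
    refine ⟨by rwa [mem_ball_zero_iff], ?_⟩
    have hv := (abs_le.1 (h.abs_sub_le (P.smul_mem 2 hp) (Pᗮ.smul_mem (1 - s) hm)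
      (by linarith))).1
    rw [norm_smul, norm_smul, Real.norm_of_nonneg (show (0 : ℝ) ≤ 2 by norm_num),
      Real.norm_of_nonneg (show 0 ≤ 1 - s by linarith [hs.2]), mul_pow, mul_pow] at hv
    have h1 : (1 - s) ^ 2 * ‖m‖ ^ 2 ≤ 2 * ‖p‖ ^ 2 := by
      have : (1 - s) ^ 2 ≤ 1 := by nlinarith [hs.1, hs.2]
      nlinarith [sq_nonneg ‖m‖]
    show g 0 < g ((2 : ℝ) • p + (1 - s) • m)
    nlinarith [sq_nonneg ‖m‖]

/-- For `P = ⊥` the point is a strict maximum. Otherwise points above the level move into `P`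
without its origin, which is connected near `0` since `P` has dimension at least two. -/
lemma ApproxSplit.raisableAt [P.HasOrthogonalProjection] (h : ApproxSplit g g' P ρ) (hρ : 0 < ρ)
    (hP : P = ⊥ ∨ 1 < Module.rank ℝ P) : RaisableAt g 0 := by
  rcases hP with rfl | hP
  · exact Or.inr (h.eventually_lt hρ)
  left
  constructor
  · obtain ⟨p, hp⟩ : ∃ p : P, p ≠ 0 := by
      have : Nontrivial P := rank_pos_iff_nontrivial.1 (zero_lt_one.trans hP)
      exact exists_ne 0
    have hp0 : (p : F) ≠ 0 := by simpa using hp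
    have ht : Tendsto (fun s : ℝ => s • (p : F)) (𝓝[>] 0) (𝓝 0) := by
      have : Tendsto (fun s : ℝ => s • (p : F)) (𝓝 0) (𝓝 ((0 : ℝ) • (p : F))) :=
        (continuous_id.smul continuous_const).tendsto 0
      rw [zero_smul] at this
      exact this.mono_left nhdsWithin_le_nhds
    refine ht.frequently (Eventually.frequently ?_)
    filter_upwards [ht.eventually (Metric.ball_mem_nhds 0 hρ), self_mem_nhdsWithin] with s hs hs0
    have hs0 : 0 < s := hs0
    exact h.lt_of_mem (P.smul_mem _ p.2) (smul_ne_zero hs0.ne' hp0) (by simpa using hs)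
  · intro V hV
    obtain ⟨R', hR', hRV'⟩ := Metric.mem_nhds_iff.1 hV
    set R := min R' ρ
    have hR : 0 < R := lt_min hR' hρ
    have hRρ : R ≤ ρ := min_le_right _ _
    have hRV : Metric.ball 0 R ⊆ V := (Metric.ball_subset_ball (min_le_left _ _)).trans hRV'
    refine ⟨Metric.ball 0 (R / 4), Metric.ball_mem_nhds _ (by linarith),
      fun a ha b hb hga hgb => ?_⟩
    have hdec : ∀ a : F, ∃ p ∈ P, ∃ m ∈ Pᗮ, a = p + m := fun a =>
      ⟨_, P.starProjection_apply_mem a, _, P.sub_starProjection_mem_orthogonal a, by abel⟩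
    obtain ⟨p, hp, m, hm, rfl⟩ := hdec a
    obtain ⟨p', hp', m', hm', rfl⟩ := hdec b
    rw [mem_ball_zero_iff] at ha hb
    obtain ⟨hp0, hpR, hj⟩ := h.joinedIn hRρ hp hm ha hga
    obtain ⟨hp0', hpR', hj'⟩ := h.joinedIn hRρ hp' hm' hb hgb
    have hsub : Metric.ball 0 R ∩ {z | g 0 < g z} ⊆ V ∩ {z | g 0 < g z} :=
      inter_subset_inter_left _ hRV
    refine JoinedIn.mono ((hj.trans ?_).trans hj'.symm) hsub
    have hmid := (joinedIn_punctured_ball (F := P) (R := R) hP (u := ⟨(2 : ℝ) • p, P.smul_mem _ hp⟩)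
      (v := ⟨(2 : ℝ) • p', P.smul_mem _ hp'⟩) (by simpa using hp0) (by simpa using hp0')
      hpR hpR').map (f := P.subtypeL) P.subtypeL.continuous
    refine hmid.mono ?_
    rintro _ ⟨z, ⟨hz0, hzR⟩, rfl⟩
    have hzR : ‖(z : F)‖ < R := hzR
    exact ⟨by simpa using hzR, h.lt_of_mem z.2 (by simpa using hz0) (hzR.trans_le hRρ)⟩

end Quadratic

/-! ### Normal form of the Hessian -/

section Diagonalization

open scoped InnerProductSpace

variable {E : Type*} [NormedAddCommGroup E] [NormedSpace ℝ E] [FiniteDimensional ℝ E]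

/-- A nondegenerate symmetric bilinear form is the difference of the inner products on a subspace
and on its orthogonal complement, in suitable linear coordinates. -/
lemma exists_diagonalization (B : LinearMap.BilinForm ℝ E) (hsymm : ∀ u v, B u v = B v u)
    (hB : B.Nondegenerate)
    (hidx : sigNeg (LinearMap.BilinMap.toQuadraticMap B) + 1 ≠ Module.finrank ℝ E) :
    ∃ (e : E ≃L[ℝ] EuclideanSpace ℝ (Fin (Module.finrank ℝ E)))
      (P : Submodule ℝ (EuclideanSpace ℝ (Fin (Module.finrank ℝ E)))),
      (P = ⊥ ∨ 1 < Module.rank ℝ P) ∧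
      ∀ p ∈ P, ∀ m ∈ Pᗮ, ∀ v, B (e.symm (p + m)) (e.symm v) = ⟪p, v⟫_ℝ - ⟪m, v⟫_ℝ := by
  set Q := LinearMap.BilinMap.toQuadraticMap B
  have hass : QuadraticMap.associated (R := ℝ) Q = B :=
    QuadraticMap.associated_left_inverse ℝ (fun u v => hsymm u v)
  obtain ⟨w, hw, hQ⟩ := QuadraticForm.equivalent_one_neg_one_weighted_sum_squared Q
    (by rw [hass]; exact hB.1)
  have hneg := QuadraticForm.sigNeg_of_equiv_weightedSumSquares hQ
  obtain ⟨e₀⟩ := hQ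
  let L : EuclideanSpace ℝ (Fin (Module.finrank ℝ E)) ≃ₗ[ℝ] (Fin (Module.finrank ℝ E) → ℝ) :=
    WithLp.linearEquiv 2 ℝ (Fin (Module.finrank ℝ E) → ℝ)
  let e : E ≃L[ℝ] EuclideanSpace ℝ (Fin (Module.finrank ℝ E)) :=
    (e₀.toLinearEquiv.trans L.symm).toContinuousLinearEquiv
  have hes : ∀ v i, e₀ (e.symm v) i = v i := fun v i => by
    have : L.symm (e₀ (e.symm v)) = v := e.apply_symm_apply v
    have h2 := congrArg L this
    rw [L.apply_symm_apply] at h2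
    exact congrFun h2 i
  let P : Submodule ℝ (EuclideanSpace ℝ (Fin (Module.finrank ℝ E))) :=
    (Pi.spanSubset ℝ {i | 0 < w i}).comap L.toLinearMap
  have hmem : ∀ p, p ∈ P ↔ ∀ i, w i = -1 → p i = 0 := fun p => by
    rw [Submodule.mem_comap, Pi.mem_spanSubset_iff]
    refine forall_congr' fun i => imp_congr_left ?_
    rcases hw i with h | h <;> norm_num [h]
  have hrank : Module.finrank ℝ P = {i | 0 < w i}.ncard := by
    rw [← Pi.dim_spanSubset (R := ℝ) (s := {i | 0 < w i})]
    exact LinearEquiv.finrank_eq (L.ofSubmodule' _)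
  -- Nondegeneracy makes all weights `1` or `-1`, so `P` has dimension equal to the dimension of `E`
  -- minus the index, and the hypothesis on the index says that this is not `1`.
  have hcard : {i | 0 < w i}.ncard + {i | w i < 0}.ncard = Module.finrank ℝ E := by
    have h := Set.ncard_add_ncard_compl {i | 0 < w i}
    have hc : {i | 0 < w i}ᶜ = {i | w i < 0} := by
      ext i
      rcases hw i with h | h <;> simp [h]
    rw [hc, Nat.card_eq_fintype_card, Fintype.card_fin] at h
    exact h
  refine ⟨e, P, ?_, fun p hp m hm v => ?_⟩
  · rcases Nat.lt_or_ge 1 (Module.finrank ℝ P) with h | h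
    · right
      rw [← Module.finrank_eq_rank]
      exact_mod_cast h
    · left
      have : Module.finrank ℝ P = 0 := by omega
      exact Submodule.finrank_eq_zero.1 this
  · have hp' := (hmem p).1 hp
    have hm' : ∀ i, w i = 1 → m i = 0 := fun i hi => by
      have h1 : EuclideanSpace.single i (1 : ℝ) ∈ P := (hmem _).2 fun j hj => by
        rw [PiLp.single_apply, if_neg]
        rintro rfl
        rw [hi] at hj
        norm_num at hj
      have := hm _ h1
      simpa [EuclideanSpace.inner_single_left] using this
    have hQw : ∀ z, B z z = ∑ i, w i * (e₀ z i * e₀ z i) := fun z => by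
      have : _ = B z z := e₀.map_app z
      rw [QuadraticMap.weightedSumSquares_apply] at this
      simpa [smul_eq_mul] using this.symm
    have hpolar : ∀ a b, B a b = ∑ i, w i * (e₀ a i * e₀ b i) := fun a b => by
      have h := hQw (a + b)
      simp only [map_add, LinearMap.add_apply, Pi.add_apply] at h
      rw [hQw a, hQw b, hsymm b a] at h
      have h2 : ∑ i, w i * ((e₀ a i + e₀ b i) * (e₀ a i + e₀ b i))
          = ∑ i, w i * (e₀ a i * e₀ a i) + ∑ i, w i * (e₀ b i * e₀ b i)
            + 2 * ∑ i, w i * (e₀ a i * e₀ b i) := by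
        rw [Finset.mul_sum, ← Finset.sum_add_distrib, ← Finset.sum_add_distrib]
        exact Finset.sum_congr rfl fun i _ => by ring
      rw [h2] at h
      linarith
    rw [hpolar]
    simp only [hes, PiLp.inner_apply, PiLp.add_apply, RCLike.inner_apply, conj_trivial]
    rw [← Finset.sum_sub_distrib]
    refine Finset.sum_congr rfl fun i _ => ?_
    rcases hw i with h | h
    · rw [hp' i h, h]; ring
    · rw [hm' i h, h]; ring

/-- The Morse lemma is not needed: differentiability of the derivative at `x` shows that it differs
from the Hessian by a small multiple of the distance, which is `ApproxSplit` in diagonalizing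
coordinates. -/
lemma raisableAt_of_nondegenerate {f : E → ℝ} {x : E} (hf : ContDiffAt ℝ 2 f x)
    (hcrit : fderiv ℝ f x = 0)
    (hB : (fderiv ℝ (fderiv ℝ f) x).toLinearMap₁₂.Nondegenerate)
    (hidx : sigNeg (LinearMap.BilinMap.toQuadraticMap (fderiv ℝ (fderiv ℝ f) x).toLinearMap₁₂) + 1
      ≠ Module.finrank ℝ E) : RaisableAt f x := by
  have hsymm : IsSymmSndFDerivAt ℝ f x := hf.isSymmSndFDerivAt (by simp)
  obtain ⟨e, P, hP, hBe⟩ := exists_diagonalization _ (fun u v => hsymm.eq u v) hB hidx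
  have hd : HasFDerivAt (fderiv ℝ f) (fderiv ℝ (fderiv ℝ f) x) x :=
    ((hf.fderiv_right (m := 1) (by norm_num)).differentiableAt (by norm_num)).hasFDerivAt
  have hdiff : ∀ᶠ y in 𝓝 x, HasFDerivAt f (fderiv ℝ f y) y := by
    filter_upwards [hf.eventually (by simp)] with y hy
    exact (hy.differentiableAt (by norm_num)).hasFDerivAt
  set S := (e.symm : EuclideanSpace ℝ (Fin (Module.finrank ℝ E)) →L[ℝ] E)
  -- The coordinate change `S` acts on both the displacement and the test vector, which multiplies
  -- the error by at most `‖S‖ ^ 2`.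
  set K := ‖S‖ ^ 2 + 1 with hK
  have hKpos : 0 < K := by positivity
  have hsmall : ∀ᶠ y in 𝓝 x, ‖fderiv ℝ f y - fderiv ℝ (fderiv ℝ f) x (y - x)‖
      ≤ 1 / 16 / K * ‖y - x‖ := by
    have := hd.isLittleO.def (show 0 < 1 / 16 / K by positivity)
    simpa [hcrit] using this
  obtain ⟨r, hr, hball⟩ := Metric.eventually_nhds_iff_ball.1 (hdiff.and hsmall)
  have hsplit : ApproxSplit (fun w => f (x + S w)) (fun w => (fderiv ℝ f (x + S w)).comp S) P
      (r / (‖S‖ + 1)) := by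
    intro p hp m hm hpm
    have hS1 : ‖S (p + m)‖ ≤ ‖S‖ * ‖p + m‖ := S.le_opNorm _
    have hy : x + S (p + m) ∈ Metric.ball x r := by
      rw [Metric.mem_ball, dist_eq_norm, add_sub_cancel_left]
      rw [lt_div_iff₀ (by positivity)] at hpm
      have := norm_nonneg (p + m)
      linarith
    obtain ⟨h1, h2⟩ := hball _ hy
    refine ⟨?_, fun v => ?_⟩
    · have h3 : HasFDerivAt (fun w => x + S w) S (p + m) := S.hasFDerivAt.const_add x
      exact HasFDerivAt.comp (p + m) h1 h3
    · rw [← hBe p hp m hm v]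
      rw [add_sub_cancel_left] at h2
      have h4 := (fderiv ℝ f (x + S (p + m)) - fderiv ℝ (fderiv ℝ f) x (S (p + m))).le_opNorm (S v)
      have hS2 : ‖S v‖ ≤ ‖S‖ * ‖v‖ := S.le_opNorm _
      refine (show _ ≤ _ from h4).trans ?_
      calc _ ≤ 1 / 16 / K * ‖S (p + m)‖ * ‖S v‖ := by gcongr
        _ ≤ 1 / 16 / K * (‖S‖ * ‖p + m‖) * (‖S‖ * ‖v‖) := by gcongr
        _ = 1 / 16 * (‖S‖ ^ 2 / K) * (‖p + m‖ * ‖v‖) := by ring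
        _ ≤ 1 / 16 * 1 * (‖p + m‖ * ‖v‖) := by
          gcongr
          rw [div_le_one hKpos, hK]
          linarith
        _ = 1 / 16 * ‖p + m‖ * ‖v‖ := by ring
  have hra := hsplit.raisableAt (by positivity) hP
  let h : E ≃ₜ EuclideanSpace ℝ (Fin (Module.finrank ℝ E)) :=
    (Homeomorph.subRight x).trans e.toHomeomorph
  have hhx : h.toOpenPartialHomeomorph x = 0 := by
    show e (x - x) = 0
    simp
  refine RaisableAt.of_openPartialHomeomorph h.toOpenPartialHomeomorph
    (g := fun w => f (x + S w)) (mem_univ x) (fun y _ => ?_) ?_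
  · show f y = f (x + e.symm (e (y - x)))
    simp
  · rw [hhx]
    exact hra

end Diagonalization

/-! ### Morse functions and short paths on manifolds -/

section Manifold

variable {n : ℕ} {X : Type*} [TopologicalSpace X] [ChartedSpace (EuclideanSpace ℝ (Fin n)) X]
  [IsManifold (𝓡 n) ∞ X]

/-- A Morse function is raisable at all points other than the critical points of index `n - 1`. -/
theorem IsMorse.raisableAt {φ : X → ℝ} (hφ : IsMorse n φ) {x : X}
    (hx : ¬ IsCriticalOfCoindexOne n φ x) : RaisableAt φ x := by
  set e := chartAt (EuclideanSpace ℝ (Fin n)) x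
  have hxe : x ∈ e.source := mem_chart_source _ x
  have hsm : ContDiffOn ℝ ∞ (φ ∘ e.symm) e.target := by
    have h1 : ContMDiffOn (𝓡 n) (𝓡 n) ∞ e.symm e.target :=
      contMDiffOn_chart_symm (I := 𝓡 n) (n := ∞) (x := x)
    exact contMDiffOn_iff_contDiffOn.1 (hφ.1.comp_contMDiffOn h1)
  have hat : ∀ y ∈ e.target, ContDiffAt ℝ ∞ (φ ∘ e.symm) y := fun y hy =>
    hsm.contDiffAt (e.open_target.mem_nhds hy)
  have hex : e x ∈ e.target := e.map_source hxe
  have hcrit : IsCritical n φ x ↔ fderiv ℝ (φ ∘ e.symm) (e x) = 0 := by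
    have hmd : MDifferentiableAt (𝓡 n) 𝓘(ℝ, ℝ) φ x := (hφ.1 x).mdifferentiableAt (by simp)
    have heq : mfderiv (𝓡 n) 𝓘(ℝ, ℝ) φ x = fderiv ℝ (φ ∘ e.symm) (e x) := by
      rw [hmd.mfderiv]
      simp only [mfld_simps, fderivWithin_univ]
      rfl
    unfold IsCritical
    rw [heq]
    rfl
  refine RaisableAt.of_openPartialHomeomorph e hxe (g := φ ∘ e.symm)
    (fun y hy => by simp [e.left_inv hy]) ?_
  by_cases hc : IsCritical n φ x
  · refine raisableAt_of_nondegenerate (contDiffAt_infty.1 (hat _ hex) 2) (hcrit.1 hc)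
      (hφ.2 x hc) ?_
    intro h
    rw [finrank_euclideanSpace_fin] at h
    exact hx ⟨hc, h⟩
  · refine raisableAt_of_fderiv_ne_zero (g' := fderiv ℝ (φ ∘ e.symm)) ?_ ?_
      (fun h => hc (hcrit.2 h))
    · filter_upwards [e.open_target.mem_nhds hex] with y hy
      exact ((hat y hy).differentiableAt (by simp)).hasFDerivAt
    · exact ((hat _ hex).fderiv_right (m := 0) (by simp)).continuousAt

/-- Manifolds have locally unique homotopy classes of paths. -/
lemma locallyUniqueHomotopy_of_chartedSpace (E : Type*) [NormedAddCommGroup E] [NormedSpace ℝ E]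
    (Y : Type*) [TopologicalSpace Y] [ChartedSpace E Y] : LocallyUniqueHomotopy Y := by
  intro y
  set e := chartAt E y
  have hy : y ∈ e.source := mem_chart_source _ y
  obtain ⟨r, hr, hball⟩ := Metric.mem_nhds_iff.1 (e.open_target.mem_nhds (e.map_source hy))
  set D := Metric.ball (e y) r
  have : ContractibleSpace D :=
    (convex_ball (e y) r).contractibleSpace ⟨e y, Metric.mem_ball_self hr⟩
  let g : C(D, Y) := ⟨fun z => e.symm z, (e.continuousOn_symm.mono hball).domRestrict⟩
  refine ⟨e.source ∩ e ⁻¹' D, inter_mem (e.open_source.mem_nhds hy)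
    ((e.continuousAt hy).preimage_mem_nhds (Metric.ball_mem_nhds _ hr)), ?_⟩
  intro a b p q hp hq
  have ha := hp ⟨0, p.source⟩
  have hb := hp ⟨1, p.target⟩
  let lift : ∀ s : Path a b, range s ⊆ e.source ∩ e ⁻¹' D →
      Path (⟨e a, ha.2⟩ : D) ⟨e b, hb.2⟩ := fun s hs =>
    { toFun := fun t => ⟨e (s t), (hs ⟨t, rfl⟩).2⟩
      continuous_toFun := Continuous.subtype_mk
        (e.continuousOn.comp_continuous s.continuous fun t => (hs ⟨t, rfl⟩).1) _
      source' := by simp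
      target' := by simp }
  -- The coordinate ball is contractible, so the lifted paths are homotopic there; `g` carries the
  -- homotopy back to `Y`.
  have h := (SimplyConnectedSpace.paths_homotopic (lift p hp) (lift q hq)).map g
  have hga : a = g ⟨e a, ha.2⟩ := (e.left_inv ha.1).symm
  have hgb : b = g ⟨e b, hb.2⟩ := (e.left_inv hb.1).symm
  have key : ∀ (s : Path a b) (hs : range s ⊆ e.source ∩ e ⁻¹' D),
      ((lift s hs).map g.continuous).cast hga hgb = s := fun s hs => by
    ext t
    exact e.left_inv (hs ⟨t, rfl⟩).1
  have h2 := h.pathCast hga hgb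
  rwa [key p hp, key q hq] at h2

end Manifold

/-! ### Neighborhood systems -/

section NbhdSystem

variable {X : Type*} [TopologicalSpace X] (S : NbhdSystem X)

lemma NbhdSystem.antitone : Antitone S.U :=
  antitone_nat_of_succ_le fun i => subset_closure.trans (S.closure_subset i)

lemma NbhdSystem.isOpen [T2Space X] (i : ℕ) : IsOpen (S.U i) :=
  isClosed_compl_iff.1 (S.isCompact_compl i).isClosed

/-- The closures of the `U i` also have empty intersection, each lying in the preceding term, so
compactness of `K` applies to them. -/
lemma NbhdSystem.exists_subset_compl {K : Set X} (hK : IsCompact K) : ∃ i, S.U i ⊆ Kᶜ := by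
  have hempty : K ∩ ⋂ i, closure (S.U i) = ∅ := by
    rw [eq_empty_iff_forall_notMem]
    rintro x ⟨-, hx⟩
    have : x ∈ ⋂ i, S.U i := mem_iInter.2 fun i => S.closure_subset i (mem_iInter.1 hx (i + 1))
    rw [S.iInter_eq_empty] at this
    exact this
  obtain ⟨i, hi⟩ := hK.elim_directed_family_closed _ (fun i => isClosed_closure) hempty
    (directed_of_isDirected_le fun i j hij => closure_mono (S.antitone hij))
  refine ⟨i, fun x hx hxK => ?_⟩
  have : x ∈ K ∩ closure (S.U i) := ⟨hxK, subset_closure hx⟩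
  rw [hi] at this
  exact this

lemma SpaceEnd.antitone {S : NbhdSystem X} (ε : SpaceEnd S) : Antitone ε.V :=
  antitone_nat_of_succ_le ε.subset

lemma SpaceEnd.subset_U {S : NbhdSystem X} (ε : SpaceEnd S) (i : ℕ) : ε.V i ⊆ S.U i := by
  obtain ⟨x, -, h⟩ := ε.isComponentOf i
  rw [h]
  exact connectedComponentIn_subset _ _

lemma SpaceEnd.isPathConnected [T2Space X] [LocallyPathConnectedSpace X] {S : NbhdSystem X}
    (ε : SpaceEnd S) (i : ℕ) : IsPathConnected (ε.V i) := by
  obtain ⟨x, hx, h⟩ := ε.isComponentOf i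
  rw [h]
  exact (S.isOpen i).connectedComponentIn.isConnected_iff_isPathConnected.1
    (isConnected_connectedComponentIn_iff.2 hx)

/-- Every end is determined by some ray. -/
theorem SpaceEnd.exists_ray [T2Space X] [LocallyCompactSpace X] [LocallyPathConnectedSpace X]
    {S : NbhdSystem X} (ε : SpaceEnd S) : ∃ r : Ray S, r.Determines ε := by
  choose x hx using fun i => (ε.isPathConnected i).nonempty
  have hj : ∀ i, JoinedIn (ε.V i) (x i) (x (i + 1)) := fun i =>
    (ε.isPathConnected i).joinedIn _ (hx i) _ (ε.subset i (hx (i + 1)))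
  let P : ∀ i, Path (x i) (x (i + 1)) := fun i => (hj i).somePath
  have hP : ∀ i u, (P i).extend u ∈ ε.V i := fun i u => by
    have : (P i).extend u ∈ range (P i) := by
      rw [← Path.extend_range]
      exact ⟨u, rfl⟩
    obtain ⟨v, hv⟩ := this
    rw [← hv]
    exact (hj i).somePath_mem v
  let γ : ℝ≥0 → X := fun s => (P ⌊s⌋₊).extend ((s : ℝ) - ⌊s⌋₊)
  -- At the right endpoint the floor has already jumped to `i + 1`; the formulas agree because `P i`
  -- ends where `P (i + 1)` starts.
  have hγ : ∀ i : ℕ, ∀ s ∈ Icc (i : ℝ≥0) (i + 1), γ s = (P i).extend ((s : ℝ) - i) := by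
    intro i s hs
    rcases hs.2.lt_or_eq with h | h
    · have : ⌊s⌋₊ = i := (Nat.floor_eq_iff zero_le).2 ⟨hs.1, h⟩
      show (P ⌊s⌋₊).extend _ = _
      rw [this]
    · have hf : ⌊s⌋₊ = i + 1 := by
        rw [h]
        exact_mod_cast Nat.floor_natCast (R := ℝ≥0) (i + 1)
      have hval : (s : ℝ) = i + 1 := by rw [h]; simp
      show (P ⌊s⌋₊).extend _ = _
      rw [hf, hval]
      simp
  have hcont : Continuous γ := by
    refine LocallyFinite.continuous (f := fun i : ℕ => Icc (i : ℝ≥0) (i + 1)) ?_ ?_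
      (fun i => isClosed_Icc) fun i => ?_
    · intro s
      refine ⟨Iio (s + 1), Iio_mem_nhds (by simp), (finite_Iio (⌊s + 1⌋₊ + 1)).subset ?_⟩
      rintro i ⟨u, hu1, hu2⟩
      have : (i : ℝ≥0) ≤ s + 1 := hu1.1.trans (le_of_lt hu2)
      exact Nat.lt_succ_of_le (Nat.le_floor this)
    · exact eq_univ_of_forall fun s =>
        mem_iUnion.2 ⟨⌊s⌋₊, Nat.floor_le zero_le, (Nat.lt_floor_add_one s).le⟩
    · refine ContinuousOn.congr ?_ (hγ i)
      exact ((P i).continuous_extend.comp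
        (NNReal.continuous_coe.sub continuous_const)).continuousOn
  have hmem : ∀ (i : ℕ) (s : ℝ≥0), (i : ℝ≥0) ≤ s → γ s ∈ ε.V i := fun i s hs =>
    ε.antitone (Nat.le_floor hs) (hP _ _)
  refine ⟨⟨⟨γ, hcont⟩, ?_, fun i s hs => ε.subset_U i (hmem i s hs)⟩, fun i => ?_⟩
  · rw [isProperMap_iff_isCompact_preimage]
    refine ⟨hcont, fun K hK => ?_⟩
    obtain ⟨j, hj⟩ := S.exists_subset_compl hK
    refine (isCompact_Icc (a := (0 : ℝ≥0)) (b := j)).of_isClosed_subset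
      (hK.isClosed.preimage hcont) fun s hs => ⟨zero_le, ?_⟩
    by_contra h
    exact hj (ε.subset_U j (hmem j s (le_of_not_ge h))) hs
  · filter_upwards [eventually_ge_atTop (i : ℝ≥0)] with s hs
    exact hmem i s hs

/-- The inclusion `U k → U i` for `i ≤ k`. -/
def inclLE {i k : ℕ} (h : i ≤ k) : C(S.U k, S.U i) :=
  ⟨Set.inclusion (S.antitone h), continuous_inclusion _⟩

end NbhdSystem

/-! ### Conjugation of loops -/

section Conj

variable {Z W : Type*} [TopologicalSpace Z] [TopologicalSpace W]

/-- The loop `q`, transported along the path `p` from the new base point to the old one. -/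
def conjLoop {x y : Z} (p : Path x y) (q : Path y y) : Path x x := (p.trans q).trans p.symm

lemma conjLoop_homotopic {x y : Z} {p p' : Path x y} {q q' : Path y y} (hp : p.Homotopic p')
    (hq : q.Homotopic q') : (conjLoop p q).Homotopic (conjLoop p' q') :=
  (hp.hcomp hq).hcomp hp.symm₂

lemma conjLoop_map {x y : Z} (p : Path x y) (q : Path y y) (f : C(Z, W)) :
    (conjLoop p q).map f.continuous = conjLoop (p.map f.continuous) (q.map f.continuous) := by
  simp only [conjLoop, Path.map_trans, Path.map_symm]

lemma conjLoop_refl_homotopic {x : Z} (q : Path x x) :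
    (conjLoop (Path.refl x) q).Homotopic q := by
  rw [conjLoop, Path.refl_symm]
  exact Path.Homotopic.trans ⟨Path.Homotopy.transRefl _⟩ ⟨Path.Homotopy.reflTrans _⟩

open Path.Homotopic.Quotient in
lemma conjLoop_conjLoop {x y z : Z} (p : Path x y) (q : Path y z) (l : Path z z) :
    (conjLoop p (conjLoop q l)).Homotopic (conjLoop (p.trans q) l) := by
  rw [← Path.Homotopic.Quotient.eq]
  simp only [conjLoop, Path.trans_symm, mk_trans, mk_symm, Path.Homotopic.Quotient.trans_assoc]

lemma conjLoop_map_conjLoop (f : C(Z, W)) {w : W} {x y : Z} (p : Path w (f x)) (q : Path x y)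
    (l : Path y y) : (conjLoop p ((conjLoop q l).map f.continuous)).Homotopic
      (conjLoop (p.trans (q.map f.continuous)) (l.map f.continuous)) := by
  rw [conjLoop_map]
  exact conjLoop_conjLoop _ _ _

end Conj

/-! ### Arcs along a ray and a Mittag-Leffler criterion -/

namespace Ray

variable {X : Type*} [TopologicalSpace X] {S : NbhdSystem X} (r : Ray S)

/-- The point `γ s` of `U i`. -/
def point (i : ℕ) (s : ℝ≥0) (hs : (i : ℝ≥0) ≤ s) : S.U i := ⟨r.γ s, r.mem i s hs⟩

/-- Paths along a ray with the same endpoints are homotopic. -/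
lemma homotopic_of_factor {i : ℕ} {s t : ℝ≥0} {hs : (i : ℝ≥0) ≤ s} {ht : (i : ℝ≥0) ≤ t}
    {p q : Path (r.point i s hs) (r.point i t ht)} {p' q' : C(unitInterval, ℝ≥0)}
    (hp' : p' 0 = s ∧ p' 1 = t ∧ ∀ u, (i : ℝ≥0) ≤ p' u)
    (hq' : q' 0 = s ∧ q' 1 = t ∧ ∀ u, (i : ℝ≥0) ≤ q' u)
    (hp : ∀ u, (p u : X) = r.γ (p' u)) (hq : ∀ u, (q u : X) = r.γ (q' u)) : p.Homotopic q := by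
  -- Clamping the parameter at `i` extends the ray to a map from the simply connected line, through
  -- which both paths factor.
  let ρ : C(ℝ, S.U i) := ⟨fun x => ⟨r.γ (max i x.toNNReal), r.mem i _ (le_max_left _ _)⟩,
    Continuous.subtype_mk (r.γ.continuous.comp
      (continuous_const.max continuous_real_toNNReal)) _⟩
  have hρ : ∀ x : ℝ≥0, (i : ℝ≥0) ≤ x → (ρ x : X) = r.γ x := fun x hx => by
    show r.γ (max i (x : ℝ).toNNReal) = _
    rw [Real.toNNReal_coe, max_eq_right hx]
  have hs' : r.point i s hs = ρ s := Subtype.ext (hρ s hs).symm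
  have ht' : r.point i t ht = ρ t := Subtype.ext (hρ t ht).symm
  let P : Path (s : ℝ) (t : ℝ) := ⟨⟨fun u => p' u, by fun_prop⟩, by simp [hp'.1], by simp [hp'.2.1]⟩
  let Q : Path (s : ℝ) (t : ℝ) := ⟨⟨fun u => q' u, by fun_prop⟩, by simp [hq'.1], by simp [hq'.2.1]⟩
  have hP : (P.map ρ.continuous).cast hs' ht' = p := by
    ext u
    exact (hρ _ (hp'.2.2 u)).trans (hp u).symm
  have hQ : (Q.map ρ.continuous).cast hs' ht' = q := by
    ext u
    exact (hρ _ (hq'.2.2 u)).trans (hq u).symm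
  have := ((SimplyConnectedSpace.paths_homotopic P Q).map ρ).pathCast hs' ht'
  rwa [hP, hQ] at this

/-- The affine parametrization of the interval from `s` to `t`. -/
def affine (s t : ℝ≥0) : C(unitInterval, ℝ≥0) :=
  ⟨fun u => unitInterval.toNNReal (unitInterval.symm u) * s + unitInterval.toNNReal u * t, by
    have := unitInterval.toNNReal_continuous
    fun_prop⟩

lemma le_affine {a s t : ℝ≥0} (hs : a ≤ s) (ht : a ≤ t) (u : unitInterval) : a ≤ affine s t u := by
  have h1 : unitInterval.toNNReal (unitInterval.symm u) + unitInterval.toNNReal u = 1 := by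
    ext
    simp
  calc a = unitInterval.toNNReal (unitInterval.symm u) * a + unitInterval.toNNReal u * a := by
        rw [← add_mul, h1, one_mul]
    _ ≤ _ := by
      show _ ≤ unitInterval.toNNReal (unitInterval.symm u) * s + unitInterval.toNNReal u * t
      gcongr

lemma affine_spec {a s t : ℝ≥0} (hs : a ≤ s) (ht : a ≤ t) :
    affine s t 0 = s ∧ affine s t 1 = t ∧ ∀ u, a ≤ affine s t u :=
  ⟨by simp [affine], by simp [affine], le_affine hs ht⟩

/-- The path along the ray from `γ s` to `γ t` in `U i`. -/
def arc (i : ℕ) (s t : ℝ≥0) (hs : (i : ℝ≥0) ≤ s) (ht : (i : ℝ≥0) ≤ t) :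
    Path (r.point i s hs) (r.point i t ht) where
  toFun u := ⟨r.γ (affine s t u), r.mem i _ (le_affine hs ht u)⟩
  continuous_toFun := Continuous.subtype_mk (r.γ.continuous.comp (affine s t).continuous) _
  source' := Subtype.ext (congrArg r.γ (affine_spec hs ht).1)
  target' := Subtype.ext (congrArg r.γ (affine_spec hs ht).2.1)

lemma arc_trans (i : ℕ) {s t u : ℝ≥0} (hs : (i : ℝ≥0) ≤ s) (ht : (i : ℝ≥0) ≤ t)
    (hu : (i : ℝ≥0) ≤ u) :
    ((r.arc i s t hs ht).trans (r.arc i t u ht hu)).Homotopic (r.arc i s u hs hu) := by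
  let A : Path s t := ⟨affine s t, (affine_spec hs ht).1, (affine_spec hs ht).2.1⟩
  let B : Path t u := ⟨affine t u, (affine_spec ht hu).1, (affine_spec ht hu).2.1⟩
  refine r.homotopic_of_factor (p' := (A.trans B).toContinuousMap) (q' := affine s u)
    ⟨(A.trans B).source, (A.trans B).target, fun v => ?_⟩ (affine_spec hs hu) (fun v => ?_)
    fun v => rfl
  · have : (A.trans B) v ∈ range A ∪ range B := by
      rw [← Path.trans_range]
      exact ⟨v, rfl⟩
    rcases this with ⟨w, hw⟩ | ⟨w, hw⟩
    · exact (le_affine hs ht w).trans hw.le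
    · exact (le_affine ht hu w).trans hw.le
  · show _ = r.γ ((A.trans B) v)
    rw [Path.trans_apply, Path.trans_apply]
    split_ifs <;> rfl

lemma segment_map_homotopic {i k : ℕ} (h : i ≤ k) (h1 : (i : ℝ≥0) ≤ k)
    (h2 : (i : ℝ≥0) ≤ (k + 1 : ℕ)) :
    Path.Homotopic (X := S.U i) (x₀ := r.point i k h1) (x₁ := r.point i (k + 1 : ℕ) h2)
      ((r.segment k).map (inclLE S h).continuous) (r.arc i k (k + 1 : ℕ) h1 h2) := by
  refine r.homotopic_of_factor
    (p' := ⟨fun u => k + unitInterval.toNNReal u,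
      continuous_const.add unitInterval.toNNReal_continuous⟩)
    (q' := affine k (k + 1 : ℕ)) ⟨by simp, by simp, fun u => h1.trans le_self_add⟩
    (affine_spec h1 h2) (fun u => rfl) fun u => rfl

lemma bond_mk (i : ℕ) (α : Path (r.basePoint (i + 1)) (r.basePoint (i + 1))) :
    r.bond i (Path.Homotopic.Quotient.mk α) =
      Path.Homotopic.Quotient.mk (conjLoop (r.segment i) (α.map (incl S i).continuous)) := by
  have h : (conjLoop (r.segment i) (α.map (incl S i).continuous)).Homotopic
      ((r.segment i).symm.symm.trans ((α.map (incl S i).continuous).trans (r.segment i).symm)) := by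
    rw [Path.symm_symm]
    exact ⟨Path.Homotopy.transAssoc _ _ _⟩
  rw [Path.Homotopic.Quotient.eq.2 h]
  rfl

/-- The composite maps of the fundamental progroup are induced by inclusion followed by the change
of base point along the ray. -/
lemma transition_mk (i m : ℕ) (hm : (i : ℝ≥0) ≤ (i + m : ℕ))
    (α : Path (r.basePoint (i + m)) (r.basePoint (i + m))) :
    transition (G := fun i => FundamentalGroup (S.U i) (r.basePoint i)) r.bond i m
      (Path.Homotopic.Quotient.mk α) =
      Path.Homotopic.Quotient.mk (conjLoop (r.arc i i (i + m : ℕ) le_rfl hm)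
        (α.map (inclLE S (Nat.le_add_right i m)).continuous)) := by
  induction m with
  | zero =>
    refine Path.Homotopic.Quotient.eq.2 ?_
    have h : (r.arc i i i le_rfl le_rfl).Homotopic (Path.refl (r.point i i le_rfl)) :=
      r.homotopic_of_factor (p' := affine i i) (q' := ContinuousMap.const _ (i : ℝ≥0))
        (affine_spec le_rfl le_rfl) ⟨rfl, rfl, fun _ => le_rfl⟩ (fun u => rfl) fun u => rfl
    refine Path.Homotopic.trans ?_ (conjLoop_homotopic h (.refl _)).symm
    exact (conjLoop_refl_homotopic _).symm
  | succ m ih =>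
    have hm' : (i : ℝ≥0) ≤ (i + m : ℕ) := by simp
    show transition (G := fun i => FundamentalGroup (S.U i) (r.basePoint i)) r.bond i m
      (r.bond (i + m) (Path.Homotopic.Quotient.mk α)) = _
    rw [bond_mk, ih hm']
    refine Path.Homotopic.Quotient.eq.2 ?_
    refine (conjLoop_map_conjLoop _ _ _ _).trans (conjLoop_homotopic ?_ (.refl _))
    exact ((Path.Homotopic.refl _).hcomp (r.segment_map_homotopic (Nat.le_add_right i m) hm'
      hm)).trans (r.arc_trans i le_rfl hm' hm)

lemma range_transition_antitone {G : ℕ → Type*} [∀ i, Group (G i)] (f : ∀ i, G (i + 1) →* G i)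
    (i : ℕ) : Antitone fun m => (transition f i m).range := by
  refine antitone_nat_of_succ_le fun m => ?_
  rintro _ ⟨g, rfl⟩
  exact ⟨f (i + m) g, rfl⟩

/-- A criterion for the fundamental progroup to be Mittag-Leffler: loops in some `U j` can be pushed
into every `U k`, within `U i` and after a change of base point along the ray. -/
lemma isMittagLeffler_of_push (h : ∀ i, ∃ m : ℕ, ∀ k, i + m ≤ k → ∃ (T : ℝ≥0)
    (hjT : ((i + m : ℕ) : ℝ≥0) ≤ T) (hkT : (k : ℝ≥0) ≤ T) (hik : i ≤ k),
    ∀ α : Path (r.point (i + m) (i + m : ℕ) le_rfl) (r.point (i + m) (i + m : ℕ) le_rfl),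
    ∃ β : Path (r.point k T hkT) (r.point k T hkT),
      Path.Homotopic (X := S.U i)
        ((conjLoop (r.arc (i + m) T (i + m : ℕ) hjT le_rfl) α).map
          (inclLE S (Nat.le_add_right i m)).continuous)
        (β.map (inclLE S hik).continuous)) : r.IsMittagLeffler := by
  intro i
  obtain ⟨m, hm⟩ := h i
  -- Images always decrease, so only the inclusion of the image from `i + m` into the one from `i +
  -- l` needs pushing.
  refine ⟨m, fun l hl => le_antisymm (range_transition_antitone _ i hl) ?_⟩
  obtain ⟨T, hjT, hkT, hik, hpush⟩ := hm (i + l) (by omega)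
  rintro _ ⟨a, rfl⟩
  obtain ⟨α, rfl⟩ := Path.Homotopic.Quotient.mk_surjective a
  obtain ⟨β, hβ⟩ := hpush α
  have hij : (i : ℝ≥0) ≤ (i + m : ℕ) := by simp
  have hil : (i : ℝ≥0) ≤ (i + l : ℕ) := by simp
  have hiT : (i : ℝ≥0) ≤ T := hil.trans hkT
  refine ⟨Path.Homotopic.Quotient.mk (conjLoop (r.arc (i + l) (i + l : ℕ) T le_rfl hkT) β), ?_⟩
  rw [r.transition_mk i l hil, r.transition_mk i m hij]
  refine Path.Homotopic.Quotient.eq.2 ?_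
  refine (conjLoop_map_conjLoop _ _ _ _).trans ?_
  refine (conjLoop_homotopic (r.arc_trans i le_rfl hil hiT) hβ.symm).trans ?_
  refine (conjLoop_map_conjLoop _ _ _ _).trans ?_
  exact conjLoop_homotopic (r.arc_trans i le_rfl hiT hij) (.refl _)

end Ray

/-- A path in `Y` with endpoints above level `b` can be pushed above level `b`. -/
theorem exists_raise_of_metrizable {Y : Type*} [TopologicalSpace Y]
    [TopologicalSpace.MetrizableSpace Y] [LocallyCompactSpace Y] [LocallyPathConnectedSpace Y]
    {f : Y → ℝ} (hf : Continuous f) (hY : LocallyUniqueHomotopy Y) {s : ℝ} (hs : ∀ y, s < f y)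
    (hK : ∀ c0 c1, s < c0 → IsCompact (f ⁻¹' Icc c0 c1)) (hr : ∀ y, RaisableAt f y)
    {x y : Y} {b : ℝ} (hx : b < f x) (hy : b < f y) (p : Path x y) :
    ∃ q : Path x y, (∀ t, b < f (q t)) ∧ p.Homotopic q := by
  let := TopologicalSpace.metrizableSpaceMetric Y
  exact exists_raise hf hY hs hK hr hx hy p

/-! ### Superlevel sets of exhausting functions -/

section

variable {X : Type*} [TopologicalSpace X]

lemma IsExhausting.isCompact_setOf_le {φ : X → ℝ} (h : IsExhausting φ) (s : ℝ) :
    IsCompact {x | φ x ≤ s} := by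
  obtain ⟨L, hL⟩ := h.2
  convert h.1.isCompact_preimage (isCompact_Icc (a := L) (b := s)) using 1
  ext x
  simp [hL ⟨x, rfl⟩]

lemma NbhdSystem.exists_subset_superlevel (S : NbhdSystem X) {φ : X → ℝ} (h : IsExhausting φ)
    (s : ℝ) : ∃ j, S.U j ⊆ {x | s < φ x} := by
  obtain ⟨j, hj⟩ := S.exists_subset_compl (h.isCompact_setOf_le s)
  exact ⟨j, fun x hx => not_le.1 fun h' : φ x ≤ s => hj hx h'⟩

lemma NbhdSystem.exists_superlevel_subset (S : NbhdSystem X) {φ : X → ℝ} (hφ : Continuous φ)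
    (i : ℕ) : ∃ b, {x | b < φ x} ⊆ S.U i := by
  obtain ⟨b, hb⟩ := (S.isCompact_compl i).bddAbove_image hφ.continuousOn
  refine ⟨b, fun x hx => ?_⟩
  by_contra h
  exact absurd (hb ⟨x, h, rfl⟩) (not_le.2 hx)

/-- Components of superlevel sets of an exhausting function meet its level bands in compact
sets. -/
lemma IsExhausting.isCompact_component_inter [LocallyConnectedSpace X] {φ : X → ℝ}
    (h : IsExhausting φ) {s c0 c1 : ℝ} (hs : s < c0) (x : X) :
    IsCompact (connectedComponentIn {z | s < φ z} x ∩ φ ⁻¹' Icc c0 c1) := by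
  have hcont := h.1.continuous
  have hopen : IsOpen {z | s < φ z} := isOpen_lt continuous_const hcont
  refine (h.1.isCompact_preimage (isCompact_Icc (a := c0) (b := c1))).of_isClosed_subset
    (isClosed_of_closure_subset fun y hy => ?_) inter_subset_right
  have hyc : y ∈ φ ⁻¹' Icc c0 c1 :=
    closure_minimal inter_subset_right (isClosed_Icc.preimage hcont) hy
  have hys : y ∈ {z | s < φ z} := hs.trans_le hyc.1
  refine ⟨?_, hyc⟩
  -- As `s < c0`, a limit point still lies in the open superlevel set; its component there is open,
  -- so it meets and equals the given one.
  obtain ⟨z, hz1, hz2, -⟩ := mem_closure_iff.1 hy _ (hopen.connectedComponentIn (x := y))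
    (mem_connectedComponentIn hys)
  rw [connectedComponentIn_eq hz2, ← connectedComponentIn_eq hz1]
  exact mem_connectedComponentIn hys

end

/-! ### Raising loops along the ray and the Mittag-Leffler property -/

section Main

variable {n : ℕ} {X : Type*} [TopologicalSpace X] [T2Space X] [SecondCountableTopology X]
  [ChartedSpace (EuclideanSpace ℝ (Fin n)) X] [IsManifold (𝓡 n) ∞ X]

/-- In a component of a superlevel set without critical points of index `n - 1`, paths can be pushed
above any level that is exceeded at their endpoints. -/
theorem exists_raise_in_component {φ : X → ℝ} (hφ : IsMorse n φ) (hex : IsExhausting φ) {s : ℝ}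
    {x₀ : X} (hD : ∀ x ∈ connectedComponentIn {z | s < φ z} x₀, ¬ IsCriticalOfCoindexOne n φ x)
    {x y : connectedComponentIn {z | s < φ z} x₀} {b : ℝ} (hx : b < φ x) (hy : b < φ y)
    (p : Path x y) : ∃ q : Path x y, (∀ t, b < φ (q t)) ∧ p.Homotopic q := by
  have : LocallyCompactSpace X := Manifold.locallyCompact_of_finiteDimensional (𝓡 n)
  have : LocallyPathConnectedSpace X :=
    ChartedSpace.locallyPathConnectedSpace (EuclideanSpace ℝ (Fin n)) X
  have : TopologicalSpace.MetrizableSpace X :=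
    TopologicalSpace.metrizableSpace_of_t3_secondCountable X
  have hcont := hex.1.continuous
  have hopen : IsOpen (connectedComponentIn {z | s < φ z} x₀) :=
    (isOpen_lt continuous_const hcont).connectedComponentIn
  let D : TopologicalSpace.Opens X := ⟨_, hopen⟩
  have : LocallyCompactSpace D := hopen.locallyCompactSpace
  have : LocallyPathConnectedSpace D := hopen.locallyPathConnectedSpace
  refine exists_raise_of_metrizable (Y := D) (f := fun z => φ z) (s := s)
    (hcont.comp continuous_subtype_val)
    (locallyUniqueHomotopy_of_chartedSpace (EuclideanSpace ℝ (Fin n)) D)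
    (fun z => (connectedComponentIn_subset {z | s < φ z} x₀ z.2 :)) (fun c0 c1 hc => ?_) (fun z => ?_)
    hx hy p
  · rw [Subtype.isCompact_iff]
    convert hex.isCompact_component_inter hc x₀ (c1 := c1) using 1
    ext z
    constructor
    · rintro ⟨w, hw, rfl⟩
      exact ⟨w.2, hw⟩
    · rintro ⟨hz, hz'⟩
      exact ⟨⟨z, hz⟩, hz', rfl⟩
  · exact RaisableAt.of_openPartialHomeomorph (D.openPartialHomeomorphSubtypeCoe ⟨z⟩)
      (g := φ) (mem_univ z) (fun _ _ => rfl) (hφ.raisableAt (hD z z.2))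

/-- If the component of a superlevel set that contains an end has only finitely many critical points
of index `n - 1`, then the fundamental progroup based at any ray determining the end is
Mittag-Leffler. -/
theorem Ray.isMittagLeffler_of_finite {S : NbhdSystem X} {ε : SpaceEnd S} (r : Ray S)
    (hr : r.Determines ε) {φ : X → ℝ} (hφ : IsMorse n φ) (hex : IsExhausting φ) {t : ℝ} {C : Set X}
    (hC : IsComponentOf C {x | t < φ x}) (hεC : ε.IsContainedIn C)
    (hfin : {x ∈ C | IsCriticalOfCoindexOne n φ x}.Finite) : r.IsMittagLeffler := by
  have hcont := hex.1.continuous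
  obtain ⟨t₀, ht₀⟩ := (hfin.image φ).bddAbove
  refine r.isMittagLeffler_of_push fun i => ?_
  obtain ⟨s₁, hs₁⟩ := S.exists_superlevel_subset hcont i
  -- Above `s` everything lies in `U i` and in `{t < φ}`, and no critical point of index `n - 1` in
  -- `C` remains.
  set s := max s₁ (max t t₀)
  have hsU : {x | s < φ x} ⊆ S.U i :=
    Subset.trans (fun x (hx : s < φ x) => (le_max_left _ _).trans_lt hx) hs₁
  have hts : t ≤ s := (le_max_left _ _).trans (le_max_right _ _)
  obtain ⟨j, hj⟩ := S.exists_subset_superlevel hex s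
  have hjs : S.U (i + j) ⊆ {x | s < φ x} := (S.antitone (Nat.le_add_left j i)).trans hj
  set D := connectedComponentIn {x | s < φ x} (r.γ (i + j : ℕ))
  have hγD : ∀ u : ℝ≥0, ((i + j : ℕ) : ℝ≥0) ≤ u → r.γ u ∈ D := by
    have himg : IsPreconnected (r.γ '' Ici ((i + j : ℕ) : ℝ≥0)) :=
      isPreconnected_Ici.image _ r.γ.continuous.continuousOn
    have hsub := himg.subset_connectedComponentIn (F := {x | s < φ x})
      (mem_image_of_mem _ self_mem_Ici)
      (by
        rintro _ ⟨u, hu, rfl⟩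
        exact hjs (r.mem _ u hu))
    exact fun u hu => hsub (mem_image_of_mem _ hu)
  have hDC : D ⊆ C := by
    obtain ⟨k, hk⟩ := hεC
    obtain ⟨u, hu1, hu2⟩ := ((hr k).and (eventually_ge_atTop ((i + j : ℕ) : ℝ≥0))).exists
    obtain ⟨c, -, rfl⟩ := hC
    rw [connectedComponentIn_eq (hk hu1)]
    exact isPreconnected_connectedComponentIn.subset_connectedComponentIn (hγD u hu2)
      ((connectedComponentIn_subset _ _).trans fun x (hx : s < φ x) => hts.trans_lt hx)
  have hDcrit : ∀ x ∈ D, ¬ IsCriticalOfCoindexOne n φ x := fun x hx hxc => by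
    have h1 : x ∈ {x | s < φ x} := connectedComponentIn_subset _ _ hx
    have h2 : φ x ≤ t₀ := ht₀ ⟨x, ⟨hDC hx, hxc⟩, rfl⟩
    have h3 : t₀ ≤ s := (le_max_right _ _).trans (le_max_right _ _)
    exact absurd (h2.trans h3) (not_le.2 h1)
  have hDU : D ⊆ S.U i := (connectedComponentIn_subset _ _).trans hsU
  refine ⟨j, fun k hk => ?_⟩
  obtain ⟨b, hb⟩ := S.exists_superlevel_subset hcont k
  obtain ⟨l, hl⟩ := S.exists_subset_superlevel hex b
  -- The loop can be raised above `b` only if its base point is above `b`, so it is first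
  -- transported along the ray to `γ T`.
  set T := max (max k (i + j)) l
  have hkT : (k : ℝ≥0) ≤ (T : ℕ) := by
    exact_mod_cast (le_max_left k (i + j)).trans (le_max_left _ _)
  have hjT : ((i + j : ℕ) : ℝ≥0) ≤ (T : ℕ) := by
    exact_mod_cast (le_max_right k (i + j)).trans (le_max_left _ _)
  have hbT : b < φ (r.γ (T : ℕ)) := hl (r.mem l _ (by exact_mod_cast le_max_right _ _))
  refine ⟨(T : ℕ), hjT, hkT, by omega, fun α => ?_⟩
  set δ := conjLoop (r.arc (i + j) (T : ℕ) (i + j : ℕ) hjT le_rfl) α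
  have hδD : ∀ u, (δ u : X) ∈ D := by
    have himg : IsPreconnected (range fun u => (δ u : X)) :=
      isPreconnected_range (continuous_subtype_val.comp δ.continuous)
    have hsub := himg.subset_connectedComponentIn (F := {x | s < φ x})
      (x := r.γ (T : ℕ)) ⟨0, congrArg Subtype.val δ.source⟩
      (by
        rintro _ ⟨u, rfl⟩
        exact hjs (δ u).2)
    rw [← connectedComponentIn_eq (hγD _ hjT)] at hsub
    exact fun u => hsub ⟨u, rfl⟩
  have hδ0 : (δ 0 : X) = r.γ (T : ℕ) := congrArg Subtype.val δ.source
  have hδ1 : (δ 1 : X) = r.γ (T : ℕ) := congrArg Subtype.val δ.target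
  let p : Path (⟨r.γ (T : ℕ), hγD _ hjT⟩ : D) ⟨r.γ (T : ℕ), hγD _ hjT⟩ :=
    { toFun := fun u => ⟨δ u, hδD u⟩
      continuous_toFun := Continuous.subtype_mk (continuous_subtype_val.comp δ.continuous) _
      source' := Subtype.ext hδ0
      target' := Subtype.ext hδ1 }
  obtain ⟨q, hq, hpq⟩ := exists_raise_in_component hφ hex hDcrit hbT hbT p
  have hq0 : (q 0 : X) = r.γ (T : ℕ) := congrArg Subtype.val q.source
  have hq1 : (q 1 : X) = r.γ (T : ℕ) := congrArg Subtype.val q.target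
  let β : Path (r.point k (T : ℕ) hkT) (r.point k (T : ℕ) hkT) :=
    { toFun := fun u => ⟨q u, hb (hq u)⟩
      continuous_toFun := Continuous.subtype_mk (continuous_subtype_val.comp q.continuous) _
      source' := Subtype.ext hq0
      target' := Subtype.ext hq1 }
  exact ⟨β, hpq.map (⟨Set.inclusion hDU, continuous_inclusion _⟩ : C(D, S.U i))⟩

end Main

end EndTheory

end

theorem proposition4p2 (n : ℕ) (X : Type*) [TopologicalSpace X] [T2Space X]
    [SecondCountableTopology X] [ChartedSpace (EuclideanSpace ℝ (Fin n)) X]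
    [IsManifold (𝓡 n) ∞ X]
    (hopen : ∀ x : X, ¬ IsCompact (connectedComponent x)) :
    (∀ (S : EndTheory.NbhdSystem X) (ε : EndTheory.SpaceEnd S), ¬ ε.IsMittagLeffler →
      ∀ φ : X → ℝ, EndTheory.IsMorse n φ → EndTheory.IsExhausting φ → ∀ t : ℝ,
        ∃ C : Set X, EndTheory.IsComponentOf C {x | t < φ x} ∧ ε.IsContainedIn C ∧
          {x ∈ C | EndTheory.IsCriticalOfCoindexOne n φ x}.Infinite) ∧
    ((∃ φ : X → ℝ, EndTheory.IsMorse n φ ∧ EndTheory.IsExhausting φ ∧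
        {x | EndTheory.IsCriticalOfCoindexOne n φ x}.Finite) →
      ∀ (S : EndTheory.NbhdSystem X) (ε : EndTheory.SpaceEnd S), ε.IsMittagLeffler) := by
  have main : ∀ (S : EndTheory.NbhdSystem X) (ε : EndTheory.SpaceEnd S), ¬ ε.IsMittagLeffler →
      ∀ φ : X → ℝ, EndTheory.IsMorse n φ → EndTheory.IsExhausting φ → ∀ t : ℝ,
        ∃ C : Set X, EndTheory.IsComponentOf C {x | t < φ x} ∧ ε.IsContainedIn C ∧
          {x ∈ C | EndTheory.IsCriticalOfCoindexOne n φ x}.Infinite := by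
    intro S ε hε φ hφ hex t
    have : LocallyCompactSpace X := Manifold.locallyCompact_of_finiteDimensional (𝓡 n)
    have : LocallyPathConnectedSpace X :=
      ChartedSpace.locallyPathConnectedSpace (EuclideanSpace ℝ (Fin n)) X
    obtain ⟨j, hj⟩ := S.exists_subset_superlevel hex t
    have hVj : ε.V j ⊆ {x | t < φ x} := (ε.subset_U j).trans hj
    obtain ⟨x, hx⟩ := (ε.isPathConnected j).nonempty
    have hC : EndTheory.IsComponentOf (connectedComponentIn {x | t < φ x} x) {x | t < φ x} :=
      ⟨x, hVj hx, rfl⟩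
    have hεC : ε.IsContainedIn (connectedComponentIn {x | t < φ x} x) :=
      ⟨j, (ε.isPathConnected j).isConnected.isPreconnected.subset_connectedComponentIn hx hVj⟩
    refine ⟨_, hC, hεC, fun hfin => hε ⟨ε.exists_ray, fun r hr => ?_⟩⟩
    exact r.isMittagLeffler_of_finite hr hφ hex hC hεC hfin
  refine ⟨main, ?_⟩
  rintro ⟨φ, hφ, hex, hfin⟩ S ε
  by_contra hε
  -- The level `0` is arbitrary.
  obtain ⟨C, -, -, hinf⟩ := main S ε hε φ hφ hex 0
  exact hinf (hfin.subset fun x hx => hx.2)
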